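/- Let $b,c,\rho>0$ and let $r:[0,\infty)\to\mathbb{R}$ satisfy: $r\in C^1([0,\infty))$ is non-decreasing; $r(0)=0$ and $r(x)\le (b+\rho)x$ for $x$ close to $0$; the limits $a:=\lim_{x\to\infty}r(x)$ and $\lim_{x\to\infty}(a-r(x))x$ exist and are finite; and $\lim_{x\to\infty}r'(x)=0$. An admissible control is a locally integrable function $u:[0,\infty)\to(0,\infty)$ with $\int_0^\infty e^{-\rho t}\ln u(t)\,dt<\infty$ (the value $-\infty$ being allowed). For $x\ge 0$ let $x(\cdot)\ge 0$ be the solution of $\dot x(t)=u(t)-bx(t)+r(x(t))$, $x(0)=x$ (in integral form), and set $$J(x;u)=\int_0^\infty e^{-\rho t}\bigl(\ln u(t)-c\,x(t)^2\bigr)\,dt\in[-\infty,\infty),\qquad V(x)=\sup_{u\text{ admissible}}J(x;u).$$ A Skiba point is a point $x_*>0$ at which $V$ is not differentiable and for which there are two optimal controls, i.e. admissible $u$ with $J(x_*;u)=V(x_*)$, that are not almost everywhere equal. Put $A=\dfrac{c}{\rho+2b}$. Then $V$ is finite on $[0,\infty)$ and, with derivatives at $0$ understood as one-sided: (i) $V$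 is differentiable at all sufficiently large $x$, and $\lim_{x\to\infty}\dfrac{V'(x)}{x}=-2A$; (ii) $V$ is twice differentiable at all sufficiently large $x$, and $\lim_{x\to\infty}V''(x)=-2A$; (iii) $V$ is twice differentiable at $0$, and $V''(0)=-(\rho+b-r'(0))\,(V'(0))^2$; (iv) at every Skiba point $x_*$, $V$ is twice differentiable on a punctured neighbourhood of $x_*$, and the limits $\lim_{x\to x_*-}V''(x)$ and $\lim_{x\to x_*+}V''(x)$ exist and are finite. -/

import Mathlib

open Set Filter Topology MeasureTheory

namespace ShallowLake

/-- The standing assumptions on the recycling rate `r : [0, ∞) → ℝ` of a lake with loss rate `b`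
and discount rate `ρ`. Only the values of `r` on `[0, ∞)` matter; `derivWithin r (Ici 0)` is the
derivative of `r` on `[0, ∞)` (one-sided at `0`). -/
structure IsRecyclingRate (b ρ : ℝ) (r : ℝ → ℝ) : Prop where
  contDiffOn : ContDiffOn ℝ 1 r (Ici 0)
  monotoneOn : MonotoneOn r (Ici 0)
  map_zero : r 0 = 0
  le_near_zero : ∀ᶠ x in 𝓝[≥] (0 : ℝ), r x ≤ (b + ρ) * x
  limits : ∃ a C : ℝ, Tendsto r atTop (𝓝 a) ∧ Tendsto (fun x => (a - r x) * x) atTop (𝓝 C)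
  deriv_tendsto : Tendsto (derivWithin r (Ici 0)) atTop (𝓝 0)

/-- `y` solves `y' = u - b y + r(y)`, `y(0) = x`, on the time interval `[0, ∞)`, in integral form
(that is, in the sense of Carathéodory), with values in the state space `[0, ∞)`. For a positive
locally integrable `u`, an initial state `x ≥ 0` and a recycling rate `r` as above there is exactly
one such function on `[0, ∞)`. -/
structure IsTrajectory (b : ℝ) (r : ℝ → ℝ) (x : ℝ) (u y : ℝ → ℝ) : Prop where
  continuousOn : ContinuousOn y (Ici 0)
  nonneg : ∀ t, 0 ≤ t → 0 ≤ y t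
  eq_integral : ∀ t, 0 ≤ t → y t = x + ∫ s in (0 : ℝ)..t, (u s - b * y s + r (y s))

/-- Admissible controls: locally integrable on `[0, ∞)`, with values in `(0, ∞)`, and such that
`∫₀^∞ e^{-ρ t} ln u(t) dt < ∞`, where the value `-∞` is allowed (`ENNReal.ofReal` cuts off the
negative part). -/
structure IsAdmissible (ρ : ℝ) (u : ℝ → ℝ) : Prop where
  pos : ∀ t, 0 ≤ t → 0 < u t
  locallyIntegrableOn : LocallyIntegrableOn u (Ici 0)
  log_integral_lt_top :
    ∫⁻ t in Ici (0 : ℝ), ENNReal.ofReal (Real.exp (-ρ * t) * Real.log (u t)) < ⊤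

/-- The total benefit `∫₀^∞ e^{-ρ t} (ln u(t) - c y(t)²) dt`, as an extended real number: the
integral of the positive part minus the integral of the negative part. For an admissible `u` the
former is finite, so that the benefit lies in `[-∞, ∞)`. -/
noncomputable def benefit (c ρ : ℝ) (u y : ℝ → ℝ) : EReal :=
  ((∫⁻ t in Ici (0 : ℝ),
      ENNReal.ofReal (Real.exp (-ρ * t) * (Real.log (u t) - c * y t ^ 2)) : ENNReal) : EReal)
  - ((∫⁻ t in Ici (0 : ℝ),
      ENNReal.ofReal (-(Real.exp (-ρ * t) * (Real.log (u t) - c * y t ^ 2))) : ENNReal) : EReal)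

/-- The value of the deterministic shallow lake problem with initial state `x`: the supremum of the
total benefit over all admissible controls, in the extended real numbers. -/
noncomputable def extendedValue (b c ρ : ℝ) (r : ℝ → ℝ) (x : ℝ) : EReal :=
  sSup {j | ∃ u y, IsAdmissible ρ u ∧ IsTrajectory b r x u y ∧ j = benefit c ρ u y}

/-- The value function `V` as a real function (it is meaningful on `[0, ∞)`). -/
noncomputable def value (b c ρ : ℝ) (r : ℝ → ℝ) (x : ℝ) : ℝ :=
  (extendedValue b c ρ r x).toReal

/-- `V'`, the derivative of `V` on `[0, ∞)` (one-sided at `0`, the usual one elsewhere). -/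
noncomputable def valueDeriv (b c ρ : ℝ) (r : ℝ → ℝ) : ℝ → ℝ :=
  derivWithin (value b c ρ r) (Ici 0)

/-- `V''`, the derivative of `V'` on `[0, ∞)` (one-sided at `0`, the usual one elsewhere). -/
noncomputable def valueDeriv₂ (b c ρ : ℝ) (r : ℝ → ℝ) : ℝ → ℝ :=
  derivWithin (valueDeriv b c ρ r) (Ici 0)

/-- `V` is differentiable on `[0, ∞)` at `x` (this says that `V'(x)` exists). -/
def HasFirst (b c ρ : ℝ) (r : ℝ → ℝ) (x : ℝ) : Prop :=
  DifferentiableWithinAt ℝ (value b c ρ r) (Ici 0) x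

/-- `V` is twice differentiable on `[0, ∞)` at `x`: `V'` exists at all points of `[0, ∞)` near `x`
and is differentiable at `x` (this says that `V''(x)` exists). -/
def HasSecond (b c ρ : ℝ) (r : ℝ → ℝ) (x : ℝ) : Prop :=
  (∀ᶠ z in 𝓝[Ici 0] x, HasFirst b c ρ r z) ∧
    DifferentiableWithinAt ℝ (valueDeriv b c ρ r) (Ici 0) x

/-- The control `u` is optimal for the initial state `x`. -/
def IsOptimal (b c ρ : ℝ) (r : ℝ → ℝ) (x : ℝ) (u : ℝ → ℝ) : Prop :=
  IsAdmissible ρ u ∧ ∃ y, IsTrajectory b r x u y ∧ benefit c ρ u y = extendedValue b c ρ r x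

/-- Skiba (indifference) points: initial states `x > 0` that have two different optimal controls
(different means: not almost everywhere equal on `[0, ∞)`) and at which the value function is
not differentiable. -/
structure IsSkibaPoint (b c ρ : ℝ) (r : ℝ → ℝ) (x : ℝ) : Prop where
  pos : 0 < x
  indifferent : ∃ u₁ u₂ : ℝ → ℝ, IsOptimal b c ρ r x u₁ ∧ IsOptimal b c ρ r x u₂ ∧
    ¬ u₁ =ᵐ[volume.restrict (Ici 0)] u₂
  not_differentiableAt : ¬ DifferentiableAt ℝ (value b c ρ r) x

end ShallowLake

/-! The value function V solves the Hamilton-Jacobi-Bellman equation `ρ V(x) = H(x, V'(x))` with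
`H(x, p) = sup_u (log u + (u - b x + r x) p) - c x² = (r x - b x) p - log (-p) - 1 - c x²`, which is
strictly convex in `p < 0`. Its derivative in p is the optimal drift `r x - b x - 1/p`. Everything
rests on comparison: a smooth supersolution that dominates V at the ends of an interval dominates it
inside (`IsLake.value_le_of_isSupersolution`). Together with steering at constant speed
(`IsLake.le_value_of_linear`) this gives local Lipschitz continuity
(`IsLake.exists_lipschitzOnWith`) and the equation at every interior point of differentiability
(`IsLake.hjb`).

By convexity the equation has at most two roots p at each x, one on either side of the minimum of
`H(x, ·)`. If some q satisfies `H(x, q) < ρ V(x)`, then q separates them, and comparison with lines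
of slope q shows that V' cannot drop through q as x grows (`IsLake.not_slope_drop`). Where V' stays
on one side of q (`IsBranch`), its limit points are unique. Hence V is C¹ there, the drift does not
vanish, and differentiating the equation gives `V'' = ((ρ + b - r') V' + 2 c x) / (r - b x - 1/V')`,
which is `secondFormula`.

The assertions follow once branches are found. At 0 the Hamiltonian is monotone in p, so it has a
single root. At a kink there are two distinct limit slopes, and their midpoint separates the two
sides. At infinity q = -1 works, by quadratic bounds on V whose leading coefficients are arbitrarily
close to `-c / (ρ + 2 b)`; these bounds also give finiteness and the asymptotics. -/

namespace ShallowLake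

/-! ### Reduction to control-trajectory pairs of finite payoff -/

/-- The discounted running benefit. -/
noncomputable def running (c ρ : ℝ) (u y : ℝ → ℝ) (t : ℝ) : ℝ :=
  Real.exp (-ρ * t) * (Real.log (u t) - c * y t ^ 2)

/-- A control-trajectory pair with finite total benefit. -/
structure FinitePair (b ρ : ℝ) (r : ℝ → ℝ) (x : ℝ) (u y : ℝ → ℝ) : Prop where
  pos : ∀ t, 0 ≤ t → 0 < u t
  locallyIntegrableOn : LocallyIntegrableOn u (Ici 0)
  traj : IsTrajectory b r x u y
  log_int : IntegrableOn (fun t => Real.exp (-ρ * t) * Real.log (u t)) (Ici 0)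
  sq_int : IntegrableOn (fun t => Real.exp (-ρ * t) * y t ^ 2) (Ici 0)

/-- The total benefit of a finite pair, as a real number. -/
noncomputable def payoff (c ρ : ℝ) (u y : ℝ → ℝ) : ℝ :=
  ∫ t in Ici (0 : ℝ), running c ρ u y t

theorem FinitePair.running_int {b c ρ : ℝ} {r : ℝ → ℝ} {x : ℝ} {u y : ℝ → ℝ}
    (h : FinitePair b ρ r x u y) : IntegrableOn (running c ρ u y) (Ici 0) := by
  have := h.log_int.sub (h.sq_int.const_mul c)
  refine this.congr (Eventually.of_forall fun t => ?_)
  simp only [running, Pi.sub_apply]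
  ring

theorem FinitePair.isAdmissible {b ρ : ℝ} {r : ℝ → ℝ} {x : ℝ} {u y : ℝ → ℝ}
    (h : FinitePair b ρ r x u y) : IsAdmissible ρ u :=
  ⟨h.pos, h.locallyIntegrableOn, h.log_int.lintegral_lt_top⟩

theorem FinitePair.benefit_eq {b c ρ : ℝ} {r : ℝ → ℝ} {x : ℝ} {u y : ℝ → ℝ}
    (h : FinitePair b ρ r x u y) : benefit c ρ u y = (payoff c ρ u y : EReal) := by
  have hf := h.running_int (c := c)
  have h1 : ∫⁻ t in Ici (0 : ℝ), ENNReal.ofReal (running c ρ u y t) ≠ ⊤ :=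
    hf.lintegral_lt_top.ne
  have h2 : ∫⁻ t in Ici (0 : ℝ), ENNReal.ofReal (-(running c ρ u y t)) ≠ ⊤ :=
    hf.neg.lintegral_lt_top.ne
  rw [payoff, integral_eq_lintegral_pos_part_sub_lintegral_neg_part hf, EReal.coe_sub,
    EReal.coe_ennreal_toReal h1, EReal.coe_ennreal_toReal h2]
  rfl

/-- The cost only lowers the integrand, so admissibility bounds its positive part, and a benefit
other than `⊥` makes the negative part finite. The cost is the log term minus the running benefit,
hence dominated by the positive part of the former plus the absolute value of the latter. -/
theorem FinitePair.of_benefit_ne_bot {b c ρ : ℝ} (hc : 0 < c) {r : ℝ → ℝ} {x : ℝ} {u y : ℝ → ℝ}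
    (hu : IsAdmissible ρ u) (hy : IsTrajectory b r x u y) (hb : benefit c ρ u y ≠ ⊥) :
    FinitePair b ρ r x u y := by
  have hum : AEStronglyMeasurable u (volume.restrict (Ici 0)) :=
    hu.locallyIntegrableOn.aestronglyMeasurable
  have hym : AEStronglyMeasurable y (volume.restrict (Ici 0)) :=
    hy.continuousOn.aestronglyMeasurable measurableSet_Ici
  have hem : AEStronglyMeasurable (fun t : ℝ => Real.exp (-ρ * t)) (volume.restrict (Ici 0)) := by
    fun_prop
  have hlm : AEStronglyMeasurable (fun t : ℝ => Real.exp (-ρ * t) * Real.log (u t))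
      (volume.restrict (Ici 0)) :=
    hem.mul (Real.measurable_log.comp_aemeasurable hum.aemeasurable).aestronglyMeasurable
  have hsm : AEStronglyMeasurable (fun t : ℝ => Real.exp (-ρ * t) * y t ^ 2)
      (volume.restrict (Ici 0)) := hem.mul (hym.pow 2)
  have hfm : AEStronglyMeasurable (running c ρ u y) (volume.restrict (Ici 0)) := by
    refine (hlm.sub (hsm.const_mul c)).congr (Eventually.of_forall fun t => ?_)
    simp only [running, Pi.sub_apply]
    ring
  have hP : ∫⁻ t in Ici (0 : ℝ), ENNReal.ofReal (running c ρ u y t) < ⊤ := by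
    refine lt_of_le_of_lt (lintegral_mono fun t => ?_) hu.log_integral_lt_top
    apply ENNReal.ofReal_le_ofReal
    unfold running
    have := Real.exp_pos (-ρ * t)
    gcongr
    nlinarith [mul_nonneg hc.le (sq_nonneg (y t))]
  have hN : ∫⁻ t in Ici (0 : ℝ), ENNReal.ofReal (-(running c ρ u y t)) < ⊤ := by
    by_contra hN
    rw [not_lt, top_le_iff] at hN
    apply hb
    have : benefit c ρ u y = ((∫⁻ t in Ici (0 : ℝ), ENNReal.ofReal (running c ρ u y t) : ENNReal)
      : EReal) - ((∫⁻ t in Ici (0 : ℝ), ENNReal.ofReal (-(running c ρ u y t)) : ENNReal)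
      : EReal) := rfl
    rw [this, hN]
    simp
  have integrable_of : ∀ g : ℝ → ℝ, AEStronglyMeasurable g (volume.restrict (Ici 0)) →
      ∫⁻ t in Ici (0 : ℝ), ENNReal.ofReal (g t) < ⊤ →
      IntegrableOn (fun t => max (g t) 0) (Ici 0) := by
    intro g hg hlt
    refine ⟨hg.sup aestronglyMeasurable_const, ?_⟩
    rw [hasFiniteIntegral_iff_ofReal (f := fun t => max (g t) 0)
      (Eventually.of_forall fun t => le_max_right _ _)]
    simpa using hlt
  have hf : IntegrableOn (running c ρ u y) (Ici 0) := by
    refine ((integrable_of _ hfm hP).sub (integrable_of _ hfm.neg hN)).congr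
      (Eventually.of_forall fun t => ?_)
    rcases le_total (running c ρ u y t) 0 with h | h <;> simp [h]
  have hcs : IntegrableOn (fun t => c * (Real.exp (-ρ * t) * y t ^ 2)) (Ici 0) := by
    refine ((integrable_of _ hlm hu.log_integral_lt_top).add hf.norm).mono' (hsm.const_mul c)
      (Eventually.of_forall fun t => ?_)
    have h1 : 0 ≤ c * (Real.exp (-ρ * t) * y t ^ 2) := by positivity
    rw [Real.norm_of_nonneg h1]
    have h2 := le_max_left (Real.exp (-ρ * t) * Real.log (u t)) 0
    have h3 := neg_abs_le (running c ρ u y t)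
    have h4 : running c ρ u y t = Real.exp (-ρ * t) * Real.log (u t)
      - c * (Real.exp (-ρ * t) * y t ^ 2) := by unfold running; ring
    simp only [Pi.add_apply, Real.norm_eq_abs]
    linarith
  have hs : IntegrableOn (fun t => Real.exp (-ρ * t) * y t ^ 2) (Ici 0) := by
    refine (hcs.const_mul c⁻¹).congr (Eventually.of_forall fun t => ?_)
    field_simp
  refine ⟨hu.pos, hu.locallyIntegrableOn, hy, ?_, hs⟩
  refine (hf.add hcs).congr (Eventually.of_forall fun t => ?_)
  simp only [running, Pi.add_apply]
  ring

/-- A finite value is a real supremum over finite pairs. -/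
theorem isLUB_value {b c ρ : ℝ} (hc : 0 < c) {r : ℝ → ℝ} {x M : ℝ}
    (hne : ∃ u y, FinitePair b ρ r x u y)
    (hM : ∀ u y, FinitePair b ρ r x u y → payoff c ρ u y ≤ M) :
    extendedValue b c ρ r x = (value b c ρ r x : EReal) ∧
    IsLUB {v | ∃ u y, FinitePair b ρ r x u y ∧ v = payoff c ρ u y} (value b c ρ r x) := by
  obtain ⟨u₀, y₀, h₀⟩ := hne
  have key : ∀ N : ℝ, (∀ u y, FinitePair b ρ r x u y → payoff c ρ u y ≤ N) →
      extendedValue b c ρ r x ≤ (N : EReal) := by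
    intro N hN
    refine sSup_le ?_
    rintro j ⟨u, y, hu, hy, rfl⟩
    by_cases hb : benefit c ρ u y = ⊥
    · rw [hb]; exact bot_le
    · have hp := FinitePair.of_benefit_ne_bot hc hu hy hb
      rw [hp.benefit_eq]
      exact_mod_cast hN u y hp
  have low : ∀ u y, FinitePair b ρ r x u y → (payoff c ρ u y : EReal) ≤ extendedValue b c ρ r x :=
    fun u y h => le_sSup ⟨u, y, h.isAdmissible, h.traj, h.benefit_eq.symm⟩
  have hval : extendedValue b c ρ r x = (value b c ρ r x : EReal) := by
    refine (EReal.coe_toReal ?_ ?_).symm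
    · exact ne_top_of_le_ne_top (EReal.coe_ne_top M) (key M hM)
    · exact ne_bot_of_le_ne_bot (EReal.coe_ne_bot _) (low u₀ y₀ h₀)
  refine ⟨hval, ?_, ?_⟩
  · rintro v ⟨u, y, h, rfl⟩
    have := low u y h
    rw [hval] at this
    exact_mod_cast this
  · intro N hN
    have := key N fun u y h => hN ⟨u, y, h, rfl⟩
    rw [hval] at this
    exact_mod_cast this

/-! ### Absolute continuity of trajectories and the verification inequality -/

theorem absolutelyContinuousOnInterval_congr {f g : ℝ → ℝ} {a b : ℝ}
    (hf : AbsolutelyContinuousOnInterval f a b) (h : EqOn f g (uIcc a b)) :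
    AbsolutelyContinuousOnInterval g a b := by
  rw [absolutelyContinuousOnInterval_iff] at hf ⊢
  intro ε hε
  obtain ⟨δ, hδ, H⟩ := hf ε hε
  refine ⟨δ, hδ, fun E hE hs => lt_of_eq_of_lt ?_ (H E hE hs)⟩
  refine Finset.sum_congr rfl fun i hi => ?_
  rw [h (hE.1 i hi).1, h (hE.1 i hi).2]

theorem absolutelyContinuousOnInterval_comp {f φ : ℝ → ℝ} {a b : ℝ} {K : NNReal} {s : Set ℝ}
    (hφ : LipschitzOnWith K φ s) (hf : AbsolutelyContinuousOnInterval f a b)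
    (h : MapsTo f (uIcc a b) s) : AbsolutelyContinuousOnInterval (fun t => φ (f t)) a b := by
  rw [absolutelyContinuousOnInterval_iff] at hf ⊢
  intro ε hε
  obtain ⟨δ, hδ, H⟩ := hf (ε / (K + 1)) (by positivity)
  refine ⟨δ, hδ, fun E hE hs => ?_⟩
  calc ∑ i ∈ Finset.range E.1, dist (φ (f (E.2 i).1)) (φ (f (E.2 i).2))
      ≤ ∑ i ∈ Finset.range E.1, (K + 1) * dist (f (E.2 i).1) (f (E.2 i).2) := by
        refine Finset.sum_le_sum fun i hi => ?_
        refine (hφ.dist_le_mul _ (h (hE.1 i hi).1) _ (h (hE.1 i hi).2)).trans ?_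
        gcongr
        simp
    _ = (K + 1) * ∑ i ∈ Finset.range E.1, dist (f (E.2 i).1) (f (E.2 i).2) := by
        rw [Finset.mul_sum]
    _ < (K + 1) * (ε / (K + 1)) := by
        have := H E hE hs
        gcongr
    _ = ε := by field_simp

/-- The integrand in the trajectory equation is integrable on compact intervals. -/
theorem IsTrajectory.intervalIntegrable {b : ℝ} {r : ℝ → ℝ} (hr : ContinuousOn r (Ici 0))
    {x : ℝ} {u y : ℝ → ℝ} (hu : LocallyIntegrableOn u (Ici 0)) (hy : IsTrajectory b r x u y)
    {s t : ℝ} (hs : 0 ≤ s) (ht : 0 ≤ t) :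
    IntervalIntegrable (fun s => u s - b * y s + r (y s)) volume s t := by
  have hsub : uIcc s t ⊆ Ici 0 := fun z hz => le_trans (le_min hs ht) hz.1
  have h1 : IntervalIntegrable u volume s t :=
    (hu.integrableOn_compact_subset hsub isCompact_uIcc).intervalIntegrable
  have hyc := hy.continuousOn.mono hsub
  have h2 : IntervalIntegrable y volume s t := hyc.intervalIntegrable
  have h3 : IntervalIntegrable (fun t => r (y t)) volume s t :=
    (hr.comp hyc fun z hz => hy.nonneg z (hsub hz)).intervalIntegrable
  exact (h1.sub (h2.const_mul b)).add h3

theorem IsTrajectory.absolutelyContinuousOnInterval {b : ℝ} {r : ℝ → ℝ}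
    (hr : ContinuousOn r (Ici 0)) {x : ℝ} {u y : ℝ → ℝ} (hu : LocallyIntegrableOn u (Ici 0))
    (hy : IsTrajectory b r x u y) {T : ℝ} (hT : 0 ≤ T) : AbsolutelyContinuousOnInterval y 0 T := by
  have h1 := (hy.intervalIntegrable hr hu le_rfl hT).absolutelyContinuousOnInterval_intervalIntegral
    (c := 0) left_mem_uIcc
  have h2 : AbsolutelyContinuousOnInterval (fun _ : ℝ => x) 0 T :=
    (LipschitzWith.const x).lipschitzOnWith.absolutelyContinuousOnInterval
  refine absolutelyContinuousOnInterval_congr (h2.add h1) fun t ht => ?_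
  rw [uIcc_of_le hT] at ht
  exact (hy.eq_integral t ht.1).symm

theorem IsTrajectory.ae_hasDerivAt {b : ℝ} {r : ℝ → ℝ}
    (hr : ContinuousOn r (Ici 0)) {x : ℝ} {u y : ℝ → ℝ} (hu : LocallyIntegrableOn u (Ici 0))
    (hy : IsTrajectory b r x u y) {T : ℝ} (hT : 0 ≤ T) :
    ∀ᵐ t, t ∈ Ioc 0 T → HasDerivAt y (u t - b * y t + r (y t)) t := by
  filter_upwards [(hy.intervalIntegrable hr hu le_rfl hT).ae_hasDerivAt_integral] with t h ht
  have h1 := (h (by rw [uIcc_of_le hT]; exact ⟨ht.1.le, ht.2⟩) 0 left_mem_uIcc).const_add x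
  refine h1.congr_of_eventuallyEq ?_
  filter_upwards [lt_mem_nhds ht.1] with s hs
  exact hy.eq_integral s hs.le

/-- This is `t + 1 ≤ exp t` at `t = log (-u p)`, with equality at the optimal feedback `u = -1/p`;
it makes `ham` the supremum over controls. -/
theorem log_add_mul_le {u p : ℝ} (hu : 0 < u) (hp : p < 0) :
    Real.log u + u * p ≤ -1 - Real.log (-p) := by
  have h := Real.add_one_le_exp (Real.log (u * -p))
  rw [Real.exp_log (mul_pos hu (neg_pos.2 hp)), Real.log_mul hu.ne' (neg_pos.2 hp).ne'] at h
  linarith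

/-- The Hamiltonian of the shallow lake problem, for a negative costate `p`. -/
noncomputable def ham (b c : ℝ) (r : ℝ → ℝ) (x p : ℝ) : ℝ :=
  (r x - b * x) * p - Real.log (-p) - 1 - c * x ^ 2

/-- `φ` is a strictly decreasing `C¹` supersolution of the Hamilton-Jacobi-Bellman equation on the
part of `[z₁, z₂]` in the state space. -/
structure IsSupersolution (b c ρ : ℝ) (r : ℝ → ℝ) (z₁ z₂ : ℝ) (φ φ' : ℝ → ℝ) : Prop where
  hasDerivAt : ∀ z ∈ Icc z₁ z₂, 0 ≤ z → HasDerivAt φ (φ' z) z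
  continuousOn : ContinuousOn φ' (Icc (max z₁ 0) z₂)
  neg : ∀ z ∈ Icc z₁ z₂, 0 ≤ z → φ' z < 0
  ham_le : ∀ z ∈ Icc z₁ z₂, 0 ≤ z → ham b c r z (φ' z) ≤ ρ * φ z

theorem FinitePair.intervalIntegrable_running {b c ρ : ℝ} {r : ℝ → ℝ} {x : ℝ} {u y : ℝ → ℝ}
    (h : FinitePair b ρ r x u y) {S T : ℝ} (hS : 0 ≤ S) (hT : 0 ≤ T) :
    IntervalIntegrable (running c ρ u y) volume S T := by
  rw [intervalIntegrable_iff]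
  refine h.running_int.mono_set fun z hz => ?_
  exact le_trans (le_min hS hT) hz.1.le

/-- The supersolution inequality says that the running benefit plus the time derivative of `exp (-ρ
t) φ(y t)` is nonpositive almost everywhere. As u is only locally integrable, the integration relies
on the absolute continuity of `φ ∘ y`. -/
theorem FinitePair.integral_running_le {b c ρ : ℝ} {r : ℝ → ℝ} (hr : ContinuousOn r (Ici 0))
    {x : ℝ} {u y : ℝ → ℝ} (h : FinitePair b ρ r x u y) {z₁ z₂ : ℝ} {φ φ' : ℝ → ℝ}
    (hφ : IsSupersolution b c ρ r z₁ z₂ φ φ') {T : ℝ} (hT : 0 ≤ T)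
    (hy : ∀ t ∈ Icc 0 T, y t ∈ Icc z₁ z₂) :
    ∫ t in (0 : ℝ)..T, running c ρ u y t ≤ φ x - Real.exp (-ρ * T) * φ (y T) := by
  have hmem : ∀ z ∈ Icc (max z₁ 0) z₂, z ∈ Icc z₁ z₂ ∧ 0 ≤ z := fun z hz =>
    ⟨⟨(le_max_left _ _).trans hz.1, hz.2⟩, (le_max_right _ _).trans hz.1⟩
  obtain ⟨C, hC⟩ := isCompact_Icc.exists_bound_of_continuousOn hφ.continuousOn
  have hlip : LipschitzOnWith (Real.toNNReal C) φ (Icc (max z₁ 0) z₂) := by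
    refine (convex_Icc _ _).lipschitzOnWith_of_nnnorm_hasDerivWithin_le
      (fun z hz => (hφ.hasDerivAt z (hmem z hz).1 (hmem z hz).2).hasDerivWithinAt) fun z hz => ?_
    rw [← NNReal.coe_le_coe, coe_nnnorm]
    exact (hC z hz).trans (Real.le_coe_toNNReal C)
  have hyac := h.traj.absolutelyContinuousOnInterval hr h.locallyIntegrableOn hT
  have hmaps : MapsTo y (uIcc 0 T) (Icc (max z₁ 0) z₂) := by
    intro t ht
    rw [uIcc_of_le hT] at ht
    exact ⟨max_le (hy t ht).1 (h.traj.nonneg t ht.1), (hy t ht).2⟩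
  have hφy := absolutelyContinuousOnInterval_comp hlip hyac hmaps
  have hexp : AbsolutelyContinuousOnInterval (fun t : ℝ => Real.exp (-ρ * t)) 0 T :=
    ContDiffOn.absolutelyContinuousOnInterval (by fun_prop)
  have hG := hexp.fun_mul hφy
  have hint := hG.integral_deriv_eq_sub
  have hy0 : y 0 = x := by simpa using h.traj.eq_integral 0 le_rfl
  simp only [hy0, mul_zero, Real.exp_zero, one_mul] at hint
  have hle : ∫ t in (0 : ℝ)..T, running c ρ u y t ≤
      ∫ t in (0 : ℝ)..T, -deriv (fun t => Real.exp (-ρ * t) * φ (y t)) t := by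
    refine intervalIntegral.integral_mono_ae_restrict hT
      (h.intervalIntegrable_running le_rfl hT) hG.intervalIntegrable_deriv.neg ?_
    rw [EventuallyLE, ae_restrict_iff' measurableSet_Icc]
    have h0 : ∀ᵐ t : ℝ, t ≠ 0 := by simp [ae_iff, measure_singleton]
    filter_upwards [h.traj.ae_hasDerivAt hr h.locallyIntegrableOn hT, h0] with t ht h0 htT
    have hyd := ht ⟨lt_of_le_of_ne htT.1 (Ne.symm h0), htT.2⟩
    have hz := hy t htT
    have hz0 := h.traj.nonneg t htT.1
    have he : HasDerivAt (fun t : ℝ => Real.exp (-ρ * t)) (Real.exp (-ρ * t) * (-ρ)) t := by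
      simpa using ((hasDerivAt_id t).const_mul (-ρ)).exp
    have hd := he.mul (HasDerivAt.comp t (hφ.hasDerivAt _ hz hz0) hyd)
    have hd' : deriv (fun t => Real.exp (-ρ * t) * φ (y t)) t = _ := hd.deriv
    rw [hd']
    have h1 := log_add_mul_le (h.pos t htT.1) (hφ.neg _ hz hz0)
    have h2 := hφ.ham_le _ hz hz0
    unfold ham at h2
    unfold running
    have h3 : Real.log (u t) - c * y t ^ 2 ≤
        ρ * φ (y t) - φ' (y t) * (u t - b * y t + r (y t)) := by linarith
    have h4 := mul_le_mul_of_nonneg_left h3 (Real.exp_pos (-ρ * t)).le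
    simp only [Function.comp_apply]
    linarith
  rw [intervalIntegral.integral_neg, hint] at hle
  linarith

theorem FinitePair.tendsto_integral_running {b c ρ : ℝ} {r : ℝ → ℝ} {x : ℝ} {u y : ℝ → ℝ}
    (h : FinitePair b ρ r x u y) :
    Tendsto (fun T => ∫ t in (0 : ℝ)..T, running c ρ u y t) atTop (𝓝 (payoff c ρ u y)) := by
  rw [payoff, integral_Ici_eq_integral_Ioi]
  exact intervalIntegral_tendsto_integral_Ioi 0
    (h.running_int.mono_set Ioi_subset_Ici_self) tendsto_id

/-! ### Quadratic upper bound of the payoff -/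

theorem integrableOn_exp_neg {ρ : ℝ} (hρ : 0 < ρ) :
    IntegrableOn (fun t : ℝ => Real.exp (-ρ * t)) (Ici 0) := by
  rw [integrableOn_Ici_iff_integrableOn_Ioi]
  exact exp_neg_integrableOn_Ioi 0 hρ

/-- A quadratic upper bound of the payoff. -/
theorem exists_payoff_le {b c ρ : ℝ} (hρ : 0 < ρ) {r : ℝ → ℝ}
    (hr : ContinuousOn r (Ici 0)) (hr0 : ∀ z, 0 ≤ z → 0 ≤ r z) {A : ℝ} (hA : 0 < A)
    (hAc : A * (ρ + 2 * b) < c) :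
    ∃ B, ∀ x u y, 0 ≤ x → FinitePair b ρ r x u y → payoff c ρ u y ≤ B - A * (1 + x) ^ 2 := by
  -- The slack δ in the quadratic term absorbs the linear term, since `K z - δ z² ≤ K² / (4 δ)`, and
  -- B collects the constants. Squaring `1 + z` instead of z keeps the slope at most `-2 A`, even at
  -- the origin.
  set δ := c - A * (ρ + 2 * b) with hδ
  have hδ0 : 0 < δ := by linarith
  set K := 2 * A * b + 2 * ρ * A with hK
  set B := (K ^ 2 / (4 * δ) + ρ * A - Real.log (2 * A) - 1) / ρ with hB
  have hρB : ρ * B = K ^ 2 / (4 * δ) + ρ * A - Real.log (2 * A) - 1 := by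
    rw [hB]; field_simp
  have hsup : ∀ Z, IsSupersolution b c ρ r 0 Z (fun z => B - A * (1 + z) ^ 2)
      (fun z => -(2 * A * (1 + z))) := by
    intro Z
    refine ⟨fun z _ _ => ?_, by fun_prop, fun z _ hz => ?_, fun z _ hz => ?_⟩
    · have h := ((((hasDerivAt_id z).const_add 1).pow 2).const_mul A).const_sub B
      refine h.congr_deriv ?_
      norm_num
      ring
    · have : 0 < 2 * A * (1 + z) := by positivity
      linarith
    · have h1 : Real.log (2 * A) ≤ Real.log (2 * A * (1 + z)) :=
        Real.log_le_log (by positivity) (le_mul_of_one_le_right (by positivity) (by linarith))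
      have h2 : 0 ≤ r z * (2 * A * (1 + z)) := mul_nonneg (hr0 z hz) (by positivity)
      have h3 : K * z - δ * z ^ 2 ≤ K ^ 2 / (4 * δ) := by
        rw [le_div_iff₀ (by positivity)]
        nlinarith [sq_nonneg (K - 2 * δ * z)]
      unfold ham
      rw [neg_neg, mul_sub, hρB]
      rw [hK, hδ] at h3
      nlinarith
  refine ⟨B, fun x u y hx h => ?_⟩
  by_contra! hlt
  set φ : ℝ → ℝ := fun z => B - A * (1 + z) ^ 2 with hφ
  obtain ⟨ε, hε, hεlt⟩ : ∃ ε > 0, φ x + ε < payoff c ρ u y :=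
    ⟨(payoff c ρ u y - φ x) / 2, by simp only [hφ]; linarith, by simp only [hφ]; linarith⟩
  obtain ⟨T₀, hT₀⟩ := eventually_atTop.1
    ((h.tendsto_integral_running (c := c)).eventually (lt_mem_nhds hεlt))
  -- Minus the discounted terminal term is at most g, which is integrable by `sq_int`. A payoff
  -- above `φ x` would keep g above ε at all large times, impossible on a half-line of infinite
  -- measure.
  set g : ℝ → ℝ := fun t => Real.exp (-ρ * t) * (|B| + 2 * A)
    + (2 * A) * (Real.exp (-ρ * t) * y t ^ 2) with hg
  have hgi : IntegrableOn g (Ici 0) :=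
    ((integrableOn_exp_neg hρ).mul_const _).add (h.sq_int.const_mul _)
  have hge : ∀ t ∈ Ici (max T₀ 0), ε ≤ g t := by
    intro t ht
    have ht0 : 0 ≤ t := (le_max_right _ _).trans ht
    obtain ⟨Z, hZ⟩ := isCompact_Icc.exists_bound_of_continuousOn
      (h.traj.continuousOn.mono (fun s (hs : s ∈ Icc 0 t) => hs.1))
    have h1 := h.integral_running_le hr (hsup Z) ht0
      fun s hs => ⟨h.traj.nonneg s hs.1, (le_abs_self _).trans (hZ s hs)⟩
    have h2 := hT₀ t ((le_max_left _ _).trans ht)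
    have h3 := Real.exp_pos (-ρ * t)
    have h4 : A * (1 + y t) ^ 2 - B ≤ |B| + 2 * A + 2 * A * y t ^ 2 := by
      have := neg_abs_le B
      nlinarith [mul_nonneg hA.le (sq_nonneg (1 - y t))]
    have h5 := mul_le_mul_of_nonneg_left h4 h3.le
    simp only [hg, hφ] at h1 h2 ⊢
    linarith
  have hgi' := hgi.mono_set (Ici_subset_Ici.2 (le_max_right T₀ 0))
  have hconst : IntegrableOn (fun _ : ℝ => ε) (Ici (max T₀ 0)) := by
    refine hgi'.mono' aestronglyMeasurable_const ?_
    rw [ae_restrict_iff' measurableSet_Ici]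
    refine Eventually.of_forall fun t ht => ?_
    rw [Real.norm_of_nonneg hε.le]
    exact hge t ht
  rw [integrableOn_const_iff] at hconst
  simp [hε.ne'] at hconst

/-! ### Shifting and concatenating trajectories -/

theorem locallyIntegrableOn_Ici_iff {u : ℝ → ℝ} :
    LocallyIntegrableOn u (Ici 0) ↔ ∀ T, 0 ≤ T → IntervalIntegrable u volume 0 T := by
  rw [locallyIntegrableOn_iff isClosed_Ici.isLocallyClosed]
  constructor
  · intro h T hT
    refine (h (uIcc 0 T) ?_ isCompact_uIcc).intervalIntegrable
    rw [uIcc_of_le hT]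
    exact fun t ht => ht.1
  · intro h k hk hkc
    obtain ⟨T, hT⟩ := hkc.isBounded.bddAbove
    have h1 := h (max T 0) (le_max_right _ _)
    rw [intervalIntegrable_iff_integrableOn_Icc_of_le (le_max_right _ _)] at h1
    exact h1.mono_set fun t ht => ⟨hk ht, (hT ht).trans (le_max_left _ _)⟩

theorem integrableOn_comp_add_left_iff {g : ℝ → ℝ} (T : ℝ) :
    IntegrableOn (fun t => g (T + t)) (Ici 0) ↔ IntegrableOn g (Ici T) := by
  have h := (measurePreserving_add_left (volume : Measure ℝ) T).integrableOn_comp_preimage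
    (measurableEmbedding_addLeft T) (f := g) (s := Ici T)
  rw [preimage_const_add_Ici, sub_self] at h
  exact h

theorem setIntegral_comp_add_left {g : ℝ → ℝ} (T : ℝ) :
    ∫ t in Ici (0 : ℝ), g (T + t) = ∫ t in Ici T, g t := by
  have h := (measurePreserving_add_left (volume : Measure ℝ) T).setIntegral_preimage_emb
    (measurableEmbedding_addLeft T) g (Ici T)
  rwa [preimage_const_add_Ici, sub_self] at h

theorem exp_shift (ρ T t : ℝ) :
    Real.exp (-ρ * t) = Real.exp (ρ * T) * Real.exp (-ρ * (T + t)) := by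
  rw [← Real.exp_add]; congr 1; ring

theorem FinitePair.shift {b ρ : ℝ} {r : ℝ → ℝ} (hr : ContinuousOn r (Ici 0)) {x : ℝ}
    {u y : ℝ → ℝ} (h : FinitePair b ρ r x u y) {T : ℝ} (hT : 0 ≤ T) :
    FinitePair b ρ r (y T) (fun t => u (T + t)) (fun t => y (T + t)) := by
  have hmaps : MapsTo (fun t => T + t) (Ici (0 : ℝ)) (Ici 0) := fun t ht => add_nonneg hT ht
  refine ⟨fun t ht => h.pos _ (add_nonneg hT ht), ?_, ⟨?_, ?_, ?_⟩, ?_, ?_⟩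
  · rw [locallyIntegrableOn_Ici_iff]
    intro S hS
    have h0 := locallyIntegrableOn_Ici_iff.1 h.locallyIntegrableOn
    have h1 := ((h0 T hT).symm.trans (h0 (T + S) (add_nonneg hT hS))).comp_add_left T
    simpa using h1
  · exact h.traj.continuousOn.comp (by fun_prop) hmaps
  · exact fun t ht => h.traj.nonneg _ (add_nonneg hT ht)
  · intro t ht
    have hTt := add_nonneg hT ht
    have h1 := intervalIntegral.integral_comp_add_left
      (fun s => u s - b * y s + r (y s)) T (a := 0) (b := t)
    simp only [add_zero] at h1
    rw [h1, h.traj.eq_integral _ hTt, h.traj.eq_integral _ hT, add_assoc,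
      intervalIntegral.integral_add_adjacent_intervals]
    · exact h.traj.intervalIntegrable hr h.locallyIntegrableOn le_rfl hT
    · exact h.traj.intervalIntegrable hr h.locallyIntegrableOn hT hTt
  · have h1 := (integrableOn_comp_add_left_iff T).2 (h.log_int.mono_set (Ici_subset_Ici.2 hT))
    refine (h1.const_mul (Real.exp (ρ * T))).congr (Eventually.of_forall fun t => ?_)
    simp only
    rw [exp_shift ρ T t]; ring
  · have h1 := (integrableOn_comp_add_left_iff T).2 (h.sq_int.mono_set (Ici_subset_Ici.2 hT))
    refine (h1.const_mul (Real.exp (ρ * T))).congr (Eventually.of_forall fun t => ?_)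
    simp only
    rw [exp_shift ρ T t]; ring

/-- Splitting the benefit at time `T`. -/
theorem FinitePair.payoff_eq {b c ρ : ℝ} {r : ℝ → ℝ} {x : ℝ}
    {u y : ℝ → ℝ} (h : FinitePair b ρ r x u y) {T : ℝ} (hT : 0 ≤ T) :
    payoff c ρ u y = (∫ t in (0 : ℝ)..T, running c ρ u y t)
      + Real.exp (-ρ * T) * payoff c ρ (fun t => u (T + t)) (fun t => y (T + t)) := by
  have h1 : Real.exp (-ρ * T) * payoff c ρ (fun t => u (T + t)) (fun t => y (T + t))
      = ∫ t in Ici T, running c ρ u y t := by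
    rw [← setIntegral_comp_add_left, payoff, ← integral_const_mul]
    refine integral_congr_ae (Eventually.of_forall fun t => ?_)
    simp only [running]
    rw [← mul_assoc, ← Real.exp_add]
    ring_nf
  rw [h1, payoff, integral_Ici_eq_integral_Ioi, integral_Ici_eq_integral_Ioi]
  refine (intervalIntegral.integral_interval_add_Ioi ?_ ?_).symm
  · exact h.running_int.mono_set Ioi_subset_Ici_self
  · exact h.running_int.mono_set fun t ht => hT.trans (le_of_lt ht)

theorem payoff_congr {c ρ : ℝ} {u y u' y' : ℝ → ℝ} (hu : ∀ t, 0 ≤ t → u t = u' t)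
    (hy : ∀ t, 0 ≤ t → y t = y' t) : payoff c ρ u y = payoff c ρ u' y' := by
  refine setIntegral_congr_fun measurableSet_Ici fun t ht => ?_
  simp only [running, hu t ht, hy t ht]

/-- A function that is continuous up to time `T` and integrable afterwards is integrable. -/
theorem integrableOn_Ici_of_split {g g₁ : ℝ → ℝ} {T : ℝ} (hT : 0 ≤ T)
    (h₁ : ContinuousOn g₁ (Icc 0 T)) (he : EqOn g₁ g (Ico 0 T))
    (h₂ : IntegrableOn (fun t => g (T + t)) (Ici 0)) : IntegrableOn g (Ici 0) := by
  rw [integrableOn_comp_add_left_iff] at h₂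
  rw [← Ico_union_Ici_eq_Ici hT]
  refine IntegrableOn.union ?_ h₂
  exact (h₁.integrableOn_Icc.mono_set Ico_subset_Icc_self).congr_fun he measurableSet_Ico

/-- Moving with constant speed `k` up to time `T` and following a finite pair afterwards. -/
theorem FinitePair.concat {b c ρ : ℝ} {r : ℝ → ℝ} (hr : ContinuousOn r (Ici 0)) {x k T : ℝ}
    (hT : 0 ≤ T) (hnn : ∀ t ∈ Icc 0 T, 0 ≤ x + k * t)
    (hpos : ∀ t ∈ Icc 0 T, 0 < k + b * (x + k * t) - r (x + k * t))
    {u y : ℝ → ℝ} (h : FinitePair b ρ r (x + k * T) u y) :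
    ∃ u' y', FinitePair b ρ r x u' y' ∧ payoff c ρ u' y' =
      (∫ t in (0 : ℝ)..T, running c ρ (fun t => k + b * (x + k * t) - r (x + k * t))
        (fun t => x + k * t) t) + Real.exp (-ρ * T) * payoff c ρ u y := by
  set u₁ : ℝ → ℝ := fun t => k + b * (x + k * t) - r (x + k * t) with hu₁
  set u' : ℝ → ℝ := fun t => if t < T then u₁ t else u (t - T) with hu'
  -- The clamped times give one formula for both phases, so continuity at the junction needs no case
  -- distinction.
  set y' : ℝ → ℝ := fun t => y (max (t - T) 0) + k * (min t T - T) with hy'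
  have hy0 : y 0 = x + k * T := by simpa using h.traj.eq_integral 0 le_rfl
  have hu'1 : ∀ t, t < T → u' t = u₁ t := fun t ht => by simp [hu', ht]
  have hy'1 : ∀ t, t ≤ T → y' t = x + k * t := fun t ht => by
    simp only [hy']
    rw [max_eq_right (by linarith), min_eq_left ht, hy0]; ring
  have hu'2 : ∀ t, 0 ≤ t → u' (T + t) = u t := fun t ht => by
    simp [hu', ht]
  have hy'2 : ∀ t, 0 ≤ t → y' (T + t) = y t := fun t ht => by
    simp [hy', ht]
  have hu₁c : ContinuousOn u₁ (Icc 0 T) := by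
    have : ContinuousOn (fun t => r (x + k * t)) (Icc 0 T) := hr.comp (by fun_prop) hnn
    exact ContinuousOn.sub (by fun_prop) this
  have htc : Continuous fun t : ℝ => max (t - T) 0 := by fun_prop
  have hy'c : ContinuousOn y' (Ici 0) := by
    have : ContinuousOn (fun t => y (max (t - T) 0)) (Ici 0) :=
      h.traj.continuousOn.comp htc.continuousOn fun t _ => mem_Ici.2 (le_max_right _ _)
    exact this.add (by fun_prop)
  have hui : IntervalIntegrable u' volume 0 T := by
    rw [intervalIntegrable_iff_integrableOn_Ico_of_le hT]
    exact (hu₁c.integrableOn_Icc.mono_set Ico_subset_Icc_self).congr_fun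
      (fun t ht => (hu'1 t ht.2).symm) measurableSet_Ico
  have hloc : LocallyIntegrableOn u' (Ici 0) := by
    rw [locallyIntegrableOn_Ici_iff]
    intro S hS
    refine IntervalIntegrable.mono_set (a := 0) (b := T + S) ?_ ?_
    · refine hui.trans ?_
      have h0 := (locallyIntegrableOn_Ici_iff.1 h.locallyIntegrableOn S hS).comp_sub_right T
      simp only [zero_add, add_comm S T] at h0
      refine h0.congr fun t ht => ?_
      rw [uIoc_of_le (by linarith)] at ht
      simp [hu', ht.1.le]
    · rw [uIcc_of_le hS, uIcc_of_le (by linarith)]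
      exact Icc_subset_Icc_right (by linarith)
  have hint1 : ∀ t, 0 ≤ t → t ≤ T →
      ∫ s in (0 : ℝ)..t, (u' s - b * y' s + r (y' s)) = k * t := by
    intro t ht htT
    have : ∫ s in (0 : ℝ)..t, (u' s - b * y' s + r (y' s)) = ∫ s in (0 : ℝ)..t, k := by
      refine intervalIntegral.integral_congr_ae ?_
      have h0 : ∀ᵐ s : ℝ, s ≠ T := by simp [ae_iff, measure_singleton]
      filter_upwards [h0] with s hs hst
      rw [uIoc_of_le ht] at hst
      have hsT : s < T := lt_of_le_of_ne (hst.2.trans htT) hs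
      rw [hu'1 s hsT, hy'1 s hsT.le]
      simp only [hu₁]; ring
    rw [this]; simp [mul_comm]
  have hnn' : ∀ t, 0 ≤ t → 0 ≤ y' t := by
    intro t ht
    rcases le_total t T with htT | htT
    · rw [hy'1 t htT]; exact hnn t ⟨ht, htT⟩
    · obtain ⟨s, rfl⟩ : ∃ s, t = T + s := ⟨t - T, by ring⟩
      rw [hy'2 s (by linarith)]
      exact h.traj.nonneg s (by linarith)
  have hgi : ∀ t, 0 ≤ t →
      IntervalIntegrable (fun s => u' s - b * y' s + r (y' s)) volume 0 t := by
    intro t ht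
    have hsub : uIcc 0 t ⊆ Ici 0 := by rw [uIcc_of_le ht]; exact fun s hs => hs.1
    have h1 := locallyIntegrableOn_Ici_iff.1 hloc t ht
    have h2 : IntervalIntegrable y' volume 0 t := (hy'c.mono hsub).intervalIntegrable
    have h3 : IntervalIntegrable (fun s => r (y' s)) volume 0 t :=
      (hr.comp (hy'c.mono hsub) fun z hz => hnn' z (hsub hz)).intervalIntegrable
    exact (h1.sub (h2.const_mul b)).add h3
  have htraj : IsTrajectory b r x u' y' := by
    refine ⟨hy'c, hnn', fun t ht => ?_⟩
    rcases le_total t T with htT | htT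
    · rw [hint1 t ht htT, hy'1 t htT]
    · obtain ⟨s, rfl⟩ : ∃ s, t = T + s := ⟨t - T, by ring⟩
      have hs : 0 ≤ s := by linarith
      rw [← intervalIntegral.integral_add_adjacent_intervals (hgi T hT)
        ((hgi T hT).symm.trans (hgi _ ht)), hint1 T hT le_rfl, hy'2 s hs,
        h.traj.eq_integral s hs, ← add_assoc]
      congr 1
      have h1 := intervalIntegral.integral_comp_add_left
        (fun s => u' s - b * y' s + r (y' s)) T (a := 0) (b := s)
      rw [add_zero] at h1
      rw [← h1]
      refine intervalIntegral.integral_congr fun w hw => ?_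
      rw [uIcc_of_le hs] at hw
      simp only [hu'2 w hw.1, hy'2 w hw.1]
  have hlin : ContinuousOn (fun t : ℝ => x + k * t) (Icc 0 T) := by fun_prop
  have hexp : ContinuousOn (fun t : ℝ => Real.exp (-ρ * t)) (Icc 0 T) := by fun_prop
  have hfp : FinitePair b ρ r x u' y' := by
    refine ⟨fun t ht => ?_, hloc, htraj, ?_, ?_⟩
    · rcases lt_or_ge t T with htT | htT
      · rw [hu'1 t htT]; exact hpos t ⟨ht, htT.le⟩
      · obtain ⟨s, rfl⟩ : ∃ s, t = T + s := ⟨t - T, by ring⟩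
        rw [hu'2 s (by linarith)]
        exact h.pos s (by linarith)
    · refine integrableOn_Ici_of_split hT
        (hexp.mul (hu₁c.log fun t ht => (hpos t ht).ne')) (fun t ht => ?_) ?_
      · simp only [Pi.mul_apply, hu'1 t ht.2]
      · refine IntegrableOn.congr_fun (h.log_int.const_mul (Real.exp (-ρ * T)))
          (fun t ht => ?_) measurableSet_Ici
        simp only [hu'2 t ht, mul_add, Real.exp_add]; ring
    · refine integrableOn_Ici_of_split hT (hexp.mul (hlin.pow 2)) (fun t ht => ?_) ?_
      · simp only [Pi.mul_apply, Pi.pow_apply, hy'1 t ht.2.le]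
      · refine IntegrableOn.congr_fun (h.sq_int.const_mul (Real.exp (-ρ * T)))
          (fun t ht => ?_) measurableSet_Ici
        simp only [hy'2 t ht, mul_add, Real.exp_add]; ring
  refine ⟨u', y', hfp, ?_⟩
  rw [hfp.payoff_eq hT, payoff_congr hu'2 hy'2]
  congr 1
  refine intervalIntegral.integral_congr_ae ?_
  have h0 : ∀ᵐ s : ℝ, s ≠ T := by simp [ae_iff, measure_singleton]
  filter_upwards [h0] with s hs hst
  rw [uIoc_of_le hT] at hst
  have hsT : s < T := lt_of_le_of_ne hst.2 hs
  simp only [running, hu'1 s hsT, hy'1 s hsT.le]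

/-! ### Quadratic lower bound by an explicit control -/

/-- A relaxation towards a large state gives a quadratic lower bound of the value. -/
theorem exists_payoff_ge {b c ρ : ℝ} (hb : 0 < b) (hc : 0 < c) (hρ : 0 < ρ) {r : ℝ → ℝ}
    (hr : ContinuousOn r (Ici 0)) (hr0 : ∀ z, 0 ≤ z → 0 ≤ r z) {a : ℝ}
    (hra : ∀ z, 0 ≤ z → r z ≤ a) :
    ∃ C₀ C₁, ∀ x, 0 ≤ x → ∃ u y, FinitePair b ρ r x u y ∧
      -(c / (ρ + 2 * b)) * x ^ 2 - C₁ * x - C₀ ≤ payoff c ρ u y := by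
  -- The control `b k - r(y)` turns the state equation into `y' = b (k - y)`. As `b k = a + 1` and
  -- `0 ≤ r ≤ a`, it stays in `[1, a + 1]`, so its logarithm is nonnegative and bounded.
  set k := (a + 1) / b with hk
  have ha : 0 ≤ a := (hr0 0 le_rfl).trans (hra 0 le_rfl)
  have hbk : b * k = a + 1 := by rw [hk]; field_simp
  have hk0 : 0 < k := by positivity
  refine ⟨c * k ^ 2 / ρ, 2 * c * k / (ρ + b), fun x hx => ?_⟩
  set y : ℝ → ℝ := fun t => k * (1 - Real.exp (-b * t)) + x * Real.exp (-b * t) with hy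
  have hyc : Continuous y := by fun_prop
  have he1 : ∀ t : ℝ, 0 ≤ t → Real.exp (-b * t) ≤ 1 := fun t ht => by
    rw [Real.exp_le_one_iff]; nlinarith
  have hy0 : ∀ t, 0 ≤ t → 0 ≤ y t := fun t ht => by
    have := he1 t ht
    have h2 := Real.exp_pos (-b * t)
    simp only [hy]
    have := mul_nonneg hk0.le (sub_nonneg.2 this)
    positivity
  have hyle : ∀ t, 0 ≤ t → y t ≤ k + x * Real.exp (-b * t) := fun t ht => by
    have h2 := Real.exp_pos (-b * t)
    simp only [hy]
    nlinarith
  have hyle2 : ∀ t, 0 ≤ t → y t ≤ k + x := fun t ht => by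
    have := hyle t ht
    have := he1 t ht
    nlinarith
  set u : ℝ → ℝ := fun t => b * k - r (y t) with hu
  have huc : ContinuousOn u (Ici 0) := by
    have : ContinuousOn (fun t => r (y t)) (Ici 0) := hr.comp hyc.continuousOn hy0
    exact continuousOn_const.sub this
  have hu1 : ∀ t, 0 ≤ t → 1 ≤ u t := fun t ht => by
    have := hra _ (hy0 t ht)
    simp only [hu]; linarith
  have hu2 : ∀ t, 0 ≤ t → u t ≤ a + 1 := fun t ht => by
    have := hr0 _ (hy0 t ht)
    simp only [hu]; linarith
  have hlc : ContinuousOn (fun t => Real.exp (-ρ * t) * Real.log (u t)) (Ici 0) :=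
    ContinuousOn.mul (by fun_prop) (huc.log fun t ht => (one_pos.trans_le (hu1 t ht)).ne')
  have hsc : Continuous (fun t => Real.exp (-ρ * t) * y t ^ 2) := by fun_prop
  have hfp : FinitePair b ρ r x u y := by
    refine ⟨fun t ht => one_pos.trans_le (hu1 t ht),
      huc.locallyIntegrableOn measurableSet_Ici, ⟨hyc.continuousOn, hy0, fun t ht => ?_⟩, ?_, ?_⟩
    · have h1 : ∀ s ∈ uIcc 0 t, HasDerivAt y (-b * (x - k) * Real.exp (-b * s)) s := by
        intro s _
        have he : HasDerivAt (fun t : ℝ => Real.exp (-b * t)) (Real.exp (-b * s) * (-b)) s := by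
          simpa using ((hasDerivAt_id s).const_mul (-b)).exp
        refine (((he.const_sub 1).const_mul k).add (he.const_mul x)).congr_deriv ?_
        ring
      have h2 := intervalIntegral.integral_eq_sub_of_hasDerivAt h1
        (Continuous.intervalIntegrable (by fun_prop) _ _)
      have h3 : ∫ s in (0 : ℝ)..t, (u s - b * y s + r (y s)) = y t - y 0 := by
        rw [← h2]
        refine intervalIntegral.integral_congr fun s _ => ?_
        simp only [hu, hy]; ring
      rw [h3]
      simp [hy]
    · refine ((integrableOn_exp_neg hρ).mul_const (Real.log (a + 1))).mono'
        (hlc.aestronglyMeasurable measurableSet_Ici) ?_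
      rw [ae_restrict_iff' measurableSet_Ici]
      refine Eventually.of_forall fun t ht => ?_
      have h1 := Real.log_nonneg (hu1 t ht)
      have h2 := Real.log_le_log (one_pos.trans_le (hu1 t ht)) (hu2 t ht)
      rw [Real.norm_of_nonneg (by positivity)]
      gcongr
    · refine ((integrableOn_exp_neg hρ).mul_const ((k + x) ^ 2)).mono'
        hsc.aestronglyMeasurable ?_
      rw [ae_restrict_iff' measurableSet_Ici]
      refine Eventually.of_forall fun t ht => ?_
      have h1 := hy0 t ht
      have h2 := hyle2 t ht
      rw [Real.norm_of_nonneg (by positivity)]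
      gcongr
  refine ⟨u, y, hfp, ?_⟩
  have hI : ∀ q : ℝ, 0 < q → IntegrableOn (fun t : ℝ => Real.exp (-q * t)) (Ici 0) ∧
      ∫ t in Ici (0 : ℝ), Real.exp (-q * t) = 1 / q := by
    intro q hq
    refine ⟨integrableOn_exp_neg hq, ?_⟩
    rw [integral_Ici_eq_integral_Ioi, integral_exp_mul_Ioi (by linarith)]
    simp
  obtain ⟨i1, e1⟩ := hI ρ hρ
  obtain ⟨i2, e2⟩ := hI (ρ + b) (by linarith)
  obtain ⟨i3, e3⟩ := hI (ρ + 2 * b) (by linarith)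
  -- Expanding `(k + x e^{-b t})²` leaves exponentials of rates ρ, `ρ + b` and `ρ + 2 b`; the last
  -- one yields the sharp coefficient `c / (ρ + 2 b)` of x².
  have hlow : ∫ t in Ici (0 : ℝ), (-(c * k ^ 2) * Real.exp (-ρ * t)
      + -(2 * c * k * x) * Real.exp (-(ρ + b) * t) + -(c * x ^ 2) * Real.exp (-(ρ + 2 * b) * t))
      ≤ payoff c ρ u y := by
    refine setIntegral_mono_on (((i1.const_mul _).add (i2.const_mul _)).add (i3.const_mul _))
      hfp.running_int measurableSet_Ici fun t ht => ?_
    have h1 := Real.log_nonneg (hu1 t ht)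
    have h2 : y t ^ 2 ≤ (k + x * Real.exp (-b * t)) ^ 2 := by
      have := hy0 t ht
      have := hyle t ht
      gcongr
    have h3 : Real.exp (-(ρ + b) * t) = Real.exp (-ρ * t) * Real.exp (-b * t) := by
      rw [← Real.exp_add]; ring_nf
    have h4 : Real.exp (-(ρ + 2 * b) * t) = Real.exp (-ρ * t) * Real.exp (-b * t) ^ 2 := by
      rw [← Real.exp_nat_mul, ← Real.exp_add]; push_cast; ring_nf
    have h5 : -(c * (k + x * Real.exp (-b * t)) ^ 2) ≤ Real.log (u t) - c * y t ^ 2 := by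
      nlinarith
    have h6 := mul_le_mul_of_nonneg_left h5 (Real.exp_pos (-ρ * t)).le
    rw [h3, h4]
    unfold running
    nlinarith
  have j1 : IntegrableOn (fun t => -(c * k ^ 2) * Real.exp (-ρ * t)) (Ici 0) := i1.const_mul _
  have j2 : IntegrableOn (fun t => -(2 * c * k * x) * Real.exp (-(ρ + b) * t)) (Ici 0) :=
    i2.const_mul _
  have j12 : IntegrableOn (fun t => -(c * k ^ 2) * Real.exp (-ρ * t)
    + -(2 * c * k * x) * Real.exp (-(ρ + b) * t)) (Ici 0) := j1.add j2
  rw [integral_add j12 (i3.const_mul _), integral_add j1 j2, integral_const_mul,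
    integral_const_mul, integral_const_mul, e1, e2, e3] at hlow
  refine le_trans (le_of_eq ?_) hlow
  ring

/-! ### Finiteness and bounds of the value function -/

/-- The data of a shallow lake problem. -/
structure IsLake (b c ρ : ℝ) (r : ℝ → ℝ) : Prop where
  hb : 0 < b
  hc : 0 < c
  hρ : 0 < ρ
  rate : IsRecyclingRate b ρ r

variable {b c ρ : ℝ} {r : ℝ → ℝ}

theorem IsLake.continuousOn (L : IsLake b c ρ r) : ContinuousOn r (Ici 0) :=
  L.rate.contDiffOn.continuousOn

theorem IsLake.nonneg (L : IsLake b c ρ r) (z : ℝ) (hz : 0 ≤ z) : 0 ≤ r z := by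
  have := L.rate.monotoneOn (mem_Ici.2 le_rfl) (mem_Ici.2 hz) hz
  rwa [L.rate.map_zero] at this

theorem IsLake.exists_rate_le (L : IsLake b c ρ r) : ∃ a, 0 ≤ a ∧ ∀ z, 0 ≤ z → r z ≤ a := by
  obtain ⟨a, _, ha, _⟩ := L.rate.limits
  have h : ∀ z, 0 ≤ z → r z ≤ a := fun z hz => by
    refine ge_of_tendsto ha ?_
    filter_upwards [eventually_ge_atTop z] with w hw
    exact L.rate.monotoneOn (mem_Ici.2 hz) (mem_Ici.2 (hz.trans hw)) hw
  exact ⟨a, (L.nonneg 0 le_rfl).trans (h 0 le_rfl), h⟩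

theorem IsLake.exists_finitePair (L : IsLake b c ρ r) {x : ℝ} (hx : 0 ≤ x) :
    ∃ u y, FinitePair b ρ r x u y := by
  obtain ⟨a, -, ha⟩ := L.exists_rate_le
  obtain ⟨C₀, C₁, h⟩ := exists_payoff_ge L.hb L.hc L.hρ L.continuousOn L.nonneg ha
  obtain ⟨u, y, h, -⟩ := h x hx
  exact ⟨u, y, h⟩

theorem IsLake.value_spec (L : IsLake b c ρ r) {x : ℝ} (hx : 0 ≤ x) :
    extendedValue b c ρ r x = (value b c ρ r x : EReal) ∧
    IsLUB {v | ∃ u y, FinitePair b ρ r x u y ∧ v = payoff c ρ u y} (value b c ρ r x) := by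
  have hb := L.hb
  have hc := L.hc
  have hρ := L.hρ
  have h : c / (2 * (ρ + 2 * b)) * (ρ + 2 * b) < c := by
    field_simp
    norm_num
  obtain ⟨B, hB⟩ := exists_payoff_le L.hρ L.continuousOn L.nonneg (by positivity) h
  exact isLUB_value L.hc (L.exists_finitePair hx) fun u y h => hB x u y hx h

theorem FinitePair.start_nonneg {x : ℝ} {u y : ℝ → ℝ} (h : FinitePair b ρ r x u y) : 0 ≤ x := by
  have h0 := h.traj.eq_integral 0 le_rfl
  rw [intervalIntegral.integral_same, add_zero] at h0
  rw [← h0]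
  exact h.traj.nonneg 0 le_rfl

theorem IsLake.payoff_le_value (L : IsLake b c ρ r) {x : ℝ} {u y : ℝ → ℝ}
    (h : FinitePair b ρ r x u y) : payoff c ρ u y ≤ value b c ρ r x :=
  (L.value_spec h.start_nonneg).2.1 ⟨u, y, h, rfl⟩

theorem IsLake.value_le (L : IsLake b c ρ r) {x M : ℝ} (hx : 0 ≤ x)
    (h : ∀ u y, FinitePair b ρ r x u y → payoff c ρ u y ≤ M) : value b c ρ r x ≤ M := by
  refine (L.value_spec hx).2.2 ?_
  rintro v ⟨u, y, hp, rfl⟩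
  exact h u y hp

theorem IsLake.exists_value_le (L : IsLake b c ρ r) {A : ℝ} (hA : 0 < A)
    (hAc : A * (ρ + 2 * b) < c) :
    ∃ B, ∀ x, 0 ≤ x → value b c ρ r x ≤ B - A * (1 + x) ^ 2 := by
  obtain ⟨B, hB⟩ := exists_payoff_le L.hρ L.continuousOn L.nonneg hA hAc
  exact ⟨B, fun x hx => L.value_le hx fun u y h => hB x u y hx h⟩

theorem IsLake.exists_le_value (L : IsLake b c ρ r) :
    ∃ C₀ C₁, ∀ x, 0 ≤ x → -(c / (ρ + 2 * b)) * x ^ 2 - C₁ * x - C₀ ≤ value b c ρ r x := by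
  obtain ⟨a, -, ha⟩ := L.exists_rate_le
  obtain ⟨C₀, C₁, h⟩ := exists_payoff_ge L.hb L.hc L.hρ L.continuousOn L.nonneg ha
  refine ⟨C₀, C₁, fun x hx => ?_⟩
  obtain ⟨u, y, hp, hle⟩ := h x hx
  exact hle.trans (L.payoff_le_value hp)

theorem IsLake.exists_abs_value_le (L : IsLake b c ρ r) (R : ℝ) :
    ∃ M, 0 ≤ M ∧ ∀ x, 0 ≤ x → x ≤ R → |value b c ρ r x| ≤ M := by
  have hb := L.hb
  have hc := L.hc
  have hρ := L.hρ
  have h : c / (2 * (ρ + 2 * b)) * (ρ + 2 * b) < c := by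
    field_simp
    norm_num
  have hA0 : 0 < c / (2 * (ρ + 2 * b)) := by positivity
  obtain ⟨B, hB⟩ := L.exists_value_le hA0 h
  obtain ⟨C₀, C₁, hC⟩ := L.exists_le_value
  refine ⟨|B| + (c / (ρ + 2 * b)) * R ^ 2 + |C₁| * |R| + |C₀|, by positivity, fun x hx hxR => ?_⟩
  have h1 := hB x hx
  have h2 := hC x hx
  have h3 : C₁ * x ≤ |C₁| * |R| :=
    mul_le_mul (le_abs_self _) (hxR.trans (le_abs_self R)) hx (abs_nonneg _)
  have h4 : c / (ρ + 2 * b) * x ^ 2 ≤ c / (ρ + 2 * b) * R ^ 2 := by gcongr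
  have h5 := le_abs_self B
  have h6 := le_abs_self C₀
  have h7 : 0 ≤ c / (2 * (ρ + 2 * b)) * (1 + x) ^ 2 := by positivity
  have h8 : 0 ≤ c / (ρ + 2 * b) * R ^ 2 := by positivity
  have h9 := abs_nonneg B
  have h10 : 0 ≤ |C₁| * |R| := by positivity
  have h11 := abs_nonneg C₀
  rw [abs_le]
  constructor <;> linarith

/-! ### Comparison principle and dynamic programming -/

/-- Comparison with a supersolution on an interval. -/
theorem IsLake.value_le_of_isSupersolution (L : IsLake b c ρ r) {z₁ z₂ : ℝ} {φ φ' : ℝ → ℝ}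
    (hφ : IsSupersolution b c ρ r z₁ z₂ φ φ') (h₁ : 0 ≤ z₁ → value b c ρ r z₁ ≤ φ z₁)
    (h₂ : value b c ρ r z₂ ≤ φ z₂) {x : ℝ} (hx : x ∈ Icc z₁ z₂) (hx0 : 0 ≤ x) :
    value b c ρ r x ≤ φ x := by
  refine L.value_le hx0 fun u y h => ?_
  have hy0 : y 0 = x := by simpa using h.traj.eq_integral 0 le_rfl
  -- The infimum of D is the first exit time. If there is no exit, discounting kills the bounded
  -- terminal term; otherwise the remaining payoff is at most the value at an end of the interval. A
  -- negative `z₁` is never reached, which is why `h₁` is conditional.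
  set D : Set ℝ := Ici 0 ∩ y ⁻¹' (Ioo z₁ z₂)ᶜ with hD
  have hDc : IsClosed D :=
    h.traj.continuousOn.preimage_isClosed_of_isClosed isClosed_Ici isOpen_Ioo.isClosed_compl
  rcases D.eq_empty_or_nonempty with hDe | hDn
  · have hin : ∀ t, 0 ≤ t → y t ∈ Ioo z₁ z₂ := by
      intro t ht
      by_contra hn
      exact (hDe ▸ (⟨ht, hn⟩ : t ∈ D) : t ∈ (∅ : Set ℝ))
    have hφc : ContinuousOn φ (Icc (max z₁ 0) z₂) := fun z hz =>
      (hφ.hasDerivAt z ⟨(le_max_left _ _).trans hz.1, hz.2⟩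
        ((le_max_right _ _).trans hz.1)).continuousAt.continuousWithinAt
    obtain ⟨M, hM⟩ := isCompact_Icc.exists_bound_of_continuousOn hφc
    have hlim : Tendsto (fun T => φ x + Real.exp (-ρ * T) * M) atTop (𝓝 (φ x + 0 * M)) := by
      refine tendsto_const_nhds.add (Tendsto.mul_const M ?_)
      refine Real.tendsto_exp_atBot.comp ?_
      exact tendsto_id.const_mul_atTop_of_neg (neg_neg_of_pos L.hρ)
    rw [zero_mul, add_zero] at hlim
    refine le_of_tendsto_of_tendsto h.tendsto_integral_running hlim ?_
    filter_upwards [eventually_ge_atTop 0] with T hT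
    have h1 := h.integral_running_le L.continuousOn hφ hT
      fun t ht => Ioo_subset_Icc_self (hin t ht.1)
    have h2 := hM (y T) ⟨max_le (hin T hT).1.le (h.traj.nonneg T hT), (hin T hT).2.le⟩
    have h3 := (abs_le.1 h2).1
    have h4 := mul_le_mul_of_nonneg_left h3 (Real.exp_pos (-ρ * T)).le
    linarith
  · have hbdd : BddBelow D := ⟨0, fun t ht => ht.1⟩
    set T := sInf D with hTdef
    have hTD : T ∈ D := hDc.csInf_mem hDn hbdd
    have hT : 0 ≤ T := hTD.1
    have hlt : ∀ t ∈ Ico 0 T, y t ∈ Icc z₁ z₂ := by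
      intro t ht
      by_contra hn
      exact absurd (csInf_le hbdd (⟨ht.1, fun h => hn (Ioo_subset_Icc_self h)⟩ : t ∈ D))
        (not_le.2 ht.2)
    have hle : ∀ t ∈ Icc 0 T, y t ∈ Icc z₁ z₂ := by
      rcases hT.eq_or_lt with h0 | h0
      · intro t ht
        have : t = 0 := le_antisymm (ht.2.trans h0.symm.le) ht.1
        rw [this, hy0]; exact hx
      · have hm : MapsTo y (Ico 0 T) (Icc z₁ z₂) := hlt
        have := hm.closure_of_continuousOn (by
          rw [closure_Ico h0.ne]
          exact h.traj.continuousOn.mono fun t ht => ht.1)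
        rwa [closure_Ico h0.ne, isClosed_Icc.closure_eq] at this
    have hyT := hle T ⟨hT, le_rfl⟩
    have hyT0 := h.traj.nonneg T hT
    have hend : value b c ρ r (y T) ≤ φ (y T) := by
      have hn : y T ∉ Ioo z₁ z₂ := hTD.2
      rcases hyT.1.eq_or_lt with he | he
      · rw [← he]; exact h₁ (he ▸ hyT0)
      · rcases hyT.2.eq_or_lt with he' | he'
        · rw [he']; exact h₂
        · exact absurd ⟨he, he'⟩ hn
    have h1 := h.integral_running_le L.continuousOn hφ hT hle
    have h2 := L.payoff_le_value (h.shift L.continuousOn hT)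
    have h3 := mul_le_mul_of_nonneg_left (h2.trans hend) (Real.exp_pos (-ρ * T)).le
    rw [h.payoff_eq hT]
    linarith

/-- The dynamic programming inequality for a motion of constant speed. -/
theorem IsLake.le_value_of_linear (L : IsLake b c ρ r) {x k T : ℝ}
    (hT : 0 ≤ T) (hnn : ∀ t ∈ Icc 0 T, 0 ≤ x + k * t)
    (hpos : ∀ t ∈ Icc 0 T, 0 < k + b * (x + k * t) - r (x + k * t)) :
    (∫ t in (0 : ℝ)..T, running c ρ (fun t => k + b * (x + k * t) - r (x + k * t))
        (fun t => x + k * t) t) + Real.exp (-ρ * T) * value b c ρ r (x + k * T)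
      ≤ value b c ρ r x := by
  set I := ∫ t in (0 : ℝ)..T, running c ρ (fun t => k + b * (x + k * t) - r (x + k * t))
        (fun t => x + k * t) t with hI
  have he := Real.exp_pos (-ρ * T)
  have h : value b c ρ r (x + k * T) ≤ (value b c ρ r x - I) / Real.exp (-ρ * T) := by
    refine L.value_le (hnn T ⟨hT, le_rfl⟩) fun u y h => ?_
    obtain ⟨u', y', h', he'⟩ := h.concat (c := c) L.continuousOn hT hnn hpos
    have := L.payoff_le_value h'
    rw [le_div_iff₀ he]
    linarith
  rw [le_div_iff₀ he] at h
  linarith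

/-! ### Local Lipschitz continuity -/

/-- Steering from x to `x + k T` with a control of at least μ loses at most `|log μ| + c Y²` per
unit of time, and the discounting of the value reached loses at most `ρ M T`. -/
theorem IsLake.value_sub_le_of_linear (L : IsLake b c ρ r) {x k T μ Y M : ℝ}
    (hT : 0 ≤ T) (hnn : ∀ t ∈ Icc 0 T, 0 ≤ x + k * t) (hY : ∀ t ∈ Icc 0 T, x + k * t ≤ Y)
    (hμ : 0 < μ) (hpos : ∀ t ∈ Icc 0 T, μ ≤ k + b * (x + k * t) - r (x + k * t))
    (hM : |value b c ρ r (x + k * T)| ≤ M) :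
    value b c ρ r (x + k * T) - value b c ρ r x
      ≤ T * (|Real.log μ| + c * Y ^ 2 + ρ * M) := by
  have hc := L.hc
  have hρ := L.hρ
  have h := L.le_value_of_linear hT hnn fun t ht => hμ.trans_le (hpos t ht)
  set u : ℝ → ℝ := fun t => k + b * (x + k * t) - r (x + k * t) with hu
  have hrc : ContinuousOn (fun t => r (x + k * t)) (Icc 0 T) :=
    L.continuousOn.comp (by fun_prop) hnn
  have huc : ContinuousOn u (Icc 0 T) := ContinuousOn.sub (by fun_prop) hrc
  have hfc : ContinuousOn (running c ρ u (fun t => x + k * t)) (Icc 0 T) :=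
    ContinuousOn.mul (by fun_prop)
      ((huc.log fun t ht => (hμ.trans_le (hpos t ht)).ne').sub (by fun_prop))
  set N := |Real.log μ| + c * Y ^ 2 with hN
  have hN0 : 0 ≤ N := by positivity
  have hlow : ∫ t in (0 : ℝ)..T, -N ≤ ∫ t in (0 : ℝ)..T, running c ρ u (fun t => x + k * t) t := by
    refine intervalIntegral.integral_mono_on hT intervalIntegrable_const
      (ContinuousOn.intervalIntegrable (by rwa [uIcc_of_le hT])) fun t ht => ?_
    have h1 := Real.log_le_log hμ (hpos t ht)
    have h2 := neg_abs_le (Real.log μ)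
    have h3 : c * (x + k * t) ^ 2 ≤ c * Y ^ 2 := by
      have := hnn t ht
      have := hY t ht
      gcongr
    have h4 : -N ≤ Real.log (u t) - c * (x + k * t) ^ 2 := by linarith
    have h5 : Real.exp (-ρ * t) ≤ 1 := by
      rw [Real.exp_le_one_iff]; nlinarith [ht.1]
    have h6 := Real.exp_pos (-ρ * t)
    unfold running
    nlinarith
  rw [intervalIntegral.integral_const, smul_eq_mul, sub_zero] at hlow
  have h5 : 1 - ρ * T ≤ Real.exp (-ρ * T) := by
    have := Real.add_one_le_exp (-ρ * T); linarith
  have h6 : Real.exp (-ρ * T) ≤ 1 := by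
    rw [Real.exp_le_one_iff]; nlinarith
  have h7 := abs_le.1 hM
  have hM0 : 0 ≤ M := (abs_nonneg _).trans hM
  have h8 : (1 - Real.exp (-ρ * T)) * value b c ρ r (x + k * T) ≤ ρ * T * M := by
    calc _ ≤ (1 - Real.exp (-ρ * T)) * M := by
          apply mul_le_mul_of_nonneg_left h7.2; linarith
      _ ≤ _ := by apply mul_le_mul_of_nonneg_right _ hM0; linarith
  linarith

/-- Moving up at speed `a + 1` is possible everywhere: as `r ≤ a`, the control needed is at least 1.
-/
theorem IsLake.exists_value_sub_le (L : IsLake b c ρ r) (R : ℝ) :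
    ∃ C, 0 ≤ C ∧ ∀ x₁ x₂, 0 ≤ x₁ → x₁ ≤ x₂ → x₂ ≤ R →
      value b c ρ r x₂ - value b c ρ r x₁ ≤ C * (x₂ - x₁) := by
  obtain ⟨a, ha0, ha⟩ := L.exists_rate_le
  obtain ⟨M, hM0, hM⟩ := L.exists_abs_value_le R
  have hc := L.hc
  have hρ := L.hρ
  have hb := L.hb
  have hk : 0 < a + 1 := by linarith
  refine ⟨(|Real.log 1| + c * R ^ 2 + ρ * M) / (a + 1), by positivity, fun x₁ x₂ h1 h12 h2 => ?_⟩
  have hT : 0 ≤ (x₂ - x₁) / (a + 1) := div_nonneg (by linarith) hk.le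
  have hx2 : x₁ + (a + 1) * ((x₂ - x₁) / (a + 1)) = x₂ := by field_simp; ring
  have hle : ∀ t ∈ Icc 0 ((x₂ - x₁) / (a + 1)), 0 ≤ (a + 1) * t ∧ x₁ + (a + 1) * t ≤ x₂ := by
    intro t ht
    refine ⟨mul_nonneg hk.le ht.1, ?_⟩
    have := mul_le_mul_of_nonneg_left ht.2 hk.le
    linarith
  have h := L.value_sub_le_of_linear (x := x₁) (k := a + 1) (μ := 1) (Y := R) (M := M) hT
    (fun t ht => by linarith [(hle t ht).1]) (fun t ht => by linarith [(hle t ht).2]) one_pos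
    (fun t ht => by
      have h3 := (hle t ht).1
      have := ha (x₁ + (a + 1) * t) (by linarith)
      have : 0 ≤ b * (x₁ + (a + 1) * t) := mul_nonneg hb.le (by linarith)
      linarith) (by rw [hx2]; exact hM _ (h1.trans h12) h2)
  rw [hx2] at h
  refine h.trans (le_of_eq ?_)
  ring

theorem IsLake.exists_rate_lipschitz_at (L : IsLake b c ρ r) {x₀ : ℝ} (hx₀ : 0 ≤ x₀) :
    ∃ K d, 0 < K ∧ 0 < d ∧ ∀ y, 0 ≤ y → |y - x₀| < d → |r y - r x₀| ≤ K * |y - x₀| := by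
  have hd : DifferentiableWithinAt ℝ r (Ici 0) x₀ :=
    (L.rate.contDiffOn.differentiableOn one_ne_zero) x₀ hx₀
  obtain ⟨K, hK, hO⟩ := hd.isBigO_sub.exists_pos
  rw [Asymptotics.IsBigOWith, eventually_nhdsWithin_iff, Metric.eventually_nhds_iff] at hO
  obtain ⟨d, hd, h⟩ := hO
  exact ⟨K, d, hK, hd, fun y hy hyd => h hyd hy⟩

/-- Near x₀ the uncontrolled state decays at a speed above `2 κ`, so descending at speed κ leaves a
control of at least κ. -/
theorem IsLake.exists_sub_value_le_of_drift_neg (L : IsLake b c ρ r) {x₀ : ℝ} (hx₀ : 0 ≤ x₀)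
    (hm : r x₀ < b * x₀) :
    ∃ C d, 0 ≤ C ∧ 0 < d ∧ ∀ x₁ x₂, 0 ≤ x₁ → x₀ - d ≤ x₁ → x₁ ≤ x₂ → x₂ ≤ x₀ + d →
      value b c ρ r x₁ - value b c ρ r x₂ ≤ C * (x₂ - x₁) := by
  have hc := L.hc
  have hρ := L.hρ
  set κ := (b * x₀ - r x₀) / 4 with hκ
  have hκ0 : 0 < κ := by rw [hκ]; linarith
  have hcont : ContinuousWithinAt (fun y => b * y - r y) (Ici 0) x₀ :=
    ContinuousWithinAt.sub (by fun_prop) (L.continuousOn x₀ hx₀)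
  have hev := hcont.eventually (lt_mem_nhds (show 2 * κ < b * x₀ - r x₀ by rw [hκ]; linarith))
  rw [eventually_nhdsWithin_iff, Metric.eventually_nhds_iff] at hev
  obtain ⟨d, hd, hev⟩ := hev
  obtain ⟨M, hM0, hM⟩ := L.exists_abs_value_le (x₀ + d)
  refine ⟨(|Real.log κ| + c * (x₀ + d) ^ 2 + ρ * M) / κ, d / 2, by positivity, by positivity,
    fun x₁ x₂ h1 h01 h12 h2 => ?_⟩
  have hT : 0 ≤ (x₂ - x₁) / κ := div_nonneg (by linarith) hκ0.le
  have hx1 : x₂ + -κ * ((x₂ - x₁) / κ) = x₁ := by field_simp; ring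
  have hle : ∀ t ∈ Icc 0 ((x₂ - x₁) / κ), x₁ ≤ x₂ + -κ * t ∧ x₂ + -κ * t ≤ x₂ := by
    intro t ht
    have h3 := mul_nonneg hκ0.le ht.1
    have h4 := mul_le_mul_of_nonneg_left ht.2 hκ0.le
    constructor <;> linarith
  have h := L.value_sub_le_of_linear (x := x₂) (k := -κ) (μ := κ) (Y := x₀ + d) (M := M) hT
    (fun t ht => by linarith [(hle t ht).1]) (fun t ht => by linarith [(hle t ht).2]) hκ0
    (fun t ht => by
      have h3 := hle t ht
      have h4 : 2 * κ < b * (x₂ + -κ * t) - r (x₂ + -κ * t) := by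
        refine hev ?_ (mem_Ici.2 (h1.trans h3.1))
        rw [Real.dist_eq, abs_lt]
        constructor <;> linarith
      linarith) (by rw [hx1]; exact hM _ h1 (by linarith))
  rw [hx1] at h
  refine h.trans (le_of_eq ?_)
  ring

/-- Here descending cannot be relied upon, and V is bounded from above by a logarithmic barrier to
the left of x₂. Its slope is `-1/D` with `D = K (x₂ - y) + ε`. Since `b y - r y ≤ D`, the drift term
of the Hamiltonian is at most 1, which cancels the constant -1, and `log D` is very negative. -/
theorem IsLake.exists_sub_value_le_of_drift_nonneg (L : IsLake b c ρ r) {x₀ : ℝ} (hx₀ : 0 ≤ x₀)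
    (hm : b * x₀ ≤ r x₀) :
    ∃ C d, 0 ≤ C ∧ 0 < d ∧ ∀ x₁ x₂, 0 ≤ x₁ → x₀ - d ≤ x₁ → x₁ ≤ x₂ → x₂ ≤ x₀ + d →
      value b c ρ r x₁ - value b c ρ r x₂ ≤ C * (x₂ - x₁) := by
  have hc := L.hc
  have hρ := L.hρ
  have hb := L.hb
  obtain ⟨K₀, d₁, hK₀, hd₁, hK⟩ := L.exists_rate_lipschitz_at hx₀
  obtain ⟨M, hM0, hM⟩ := L.exists_abs_value_le (x₀ + d₁)
  set K := b + K₀ with hKdef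
  have hKpos : 0 < K := by positivity
  set E := Real.exp (-(ρ * M)) with hE
  have hE0 : 0 < E := Real.exp_pos _
  set d := min (d₁ / 2) (E / (2 * K)) with hd
  have hd0 : 0 < d := by positivity
  have hdd : d < d₁ := (min_le_left _ _).trans_lt (by linarith)
  have hKd : K * d ≤ E / 2 := by
    calc K * d ≤ K * (E / (2 * K)) := by gcongr; exact min_le_right _ _
      _ = E / 2 := by field_simp
  -- The first bound ensures `D ≤ E`, hence `log D ≤ -ρ M`; the second lifts the barrier by at least
  -- `2 M` at the left end `x₀ - d`. The slope at x₂ gives the Lipschitz constant `1 / ε`.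
  set ε := min (E / 4) (K * d * Real.exp (-(2 * M * K))) with hε
  have hε0 : 0 < ε := by positivity
  have hε1 : ε ≤ E / 4 := min_le_left _ _
  have hε2 : ε ≤ K * d * Real.exp (-(2 * M * K)) := min_le_right _ _
  have hε3 : ε ≤ K * d := by
    refine hε2.trans (mul_le_of_le_one_right (by positivity) ?_)
    rw [Real.exp_le_one_iff]
    have : 0 ≤ 2 * M * K := by positivity
    linarith
  have hεd : ε / K ≤ d := by rw [div_le_iff₀ hKpos]; linarith
  have hKε : K * (ε / K) = ε := by field_simp
  refine ⟨1 / ε, ε / K, by positivity, by positivity, fun x₁ x₂ h1 h01 h12 h2 => ?_⟩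
  have hx2 : 0 ≤ x₂ := h1.trans h12
  have hV2 := hM x₂ hx2 (by linarith)
  set φ : ℝ → ℝ := fun y => value b c ρ r x₂
    + 1 / K * (Real.log (K * (x₂ - y) + ε) - Real.log ε) with hφ
  have hD : ∀ y ≤ x₂, ε ≤ K * (x₂ - y) + ε := fun y hy => by
    have := mul_nonneg hKpos.le (sub_nonneg.2 hy)
    linarith
  have hsup : IsSupersolution b c ρ r (x₀ - d) x₂ φ (fun y => -(1 / (K * (x₂ - y) + ε))) := by
    refine ⟨fun y hy _ => ?_, ?_, fun y hy _ => ?_, fun y hy hy0 => ?_⟩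
    · have hpos := hε0.trans_le (hD y hy.2)
      have h3 : HasDerivAt (fun y => K * (x₂ - y) + ε) (-K) y := by
        refine ((((hasDerivAt_id y).const_sub x₂).const_mul K).add_const ε).congr_deriv ?_
        ring
      refine ((((h3.log hpos.ne').sub_const (Real.log ε)).const_mul (1 / K)).const_add
        (value b c ρ r x₂)).congr_deriv ?_
      field_simp
    · refine ContinuousOn.neg (ContinuousOn.div (by fun_prop) (by fun_prop) fun y hy => ?_)
      exact (hε0.trans_le (hD y hy.2)).ne'
    · have hpos := hε0.trans_le (hD y hy.2)
      have : 0 < 1 / (K * (x₂ - y) + ε) := by positivity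
      linarith
    · set D := K * (x₂ - y) + ε with hDdef
      have hpos : 0 < D := hε0.trans_le (hD y hy.2)
      have hDE : D ≤ E := by
        have : K * (x₂ - y) ≤ K * (ε / K + d) := by gcongr; linarith [hy.1]
        rw [mul_add, hKε] at this
        linarith
      have habs : |y - x₀| ≤ x₂ - y + ε / K := by
        rw [abs_le]; constructor <;> linarith [hy.2]
      have habs2 : |y - x₀| < d₁ := by
        rw [abs_lt]; constructor <;> linarith [hy.1, hy.2]
      have hr1 := (abs_le.1 (hK y hy0 habs2)).1
      have hbr : b * y - r y ≤ D := by
        have h4 : b * (y - x₀) ≤ b * |y - x₀| := by gcongr; exact le_abs_self _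
        have h5 : K * |y - x₀| ≤ K * (x₂ - y + ε / K) := by gcongr
        rw [mul_add, hKε] at h5
        have h6 : K * |y - x₀| = b * |y - x₀| + K₀ * |y - x₀| := by rw [hKdef]; ring
        linarith
      have hlog : Real.log D ≤ -(ρ * M) := by
        have := Real.log_le_log hpos hDE
        rwa [hE, Real.log_exp] at this
      have h7 : (r y - b * y) * -(1 / D) ≤ 1 := by
        have : (r y - b * y) * -(1 / D) = (b * y - r y) / D := by ring
        rw [this, div_le_one hpos]; exact hbr
      have h8 : 0 ≤ 1 / K * (Real.log D - Real.log ε) := by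
        have := Real.log_le_log hε0 (hD y hy.2)
        have h9 : 0 ≤ Real.log D - Real.log ε := by linarith
        positivity
      have h10 : -(ρ * M) ≤ ρ * φ y := by
        have h11 : -M ≤ φ y := by
          simp only [hφ]
          linarith [(abs_le.1 hV2).1]
        have := mul_le_mul_of_nonneg_left h11 hρ.le
        linarith
      unfold ham
      rw [neg_neg, one_div, Real.log_inv, ← one_div]
      have := mul_nonneg hc.le (sq_nonneg y)
      linarith
  have hkey := L.value_le_of_isSupersolution hsup (fun hz0 => ?_) (by simp [hφ])
    (x := x₁) ⟨by linarith, h12⟩ h1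
  · have h3 : Real.log (K * (x₂ - x₁) + ε) - Real.log ε ≤ K * (x₂ - x₁) / ε := by
      rw [← Real.log_div (hε0.trans_le (hD x₁ h12)).ne' hε0.ne']
      refine (Real.log_le_sub_one_of_pos
        (div_pos (hε0.trans_le (hD x₁ h12)) hε0)).trans (le_of_eq ?_)
      field_simp
      ring
    have h4 : 1 / K * (Real.log (K * (x₂ - x₁) + ε) - Real.log ε) ≤ 1 / ε * (x₂ - x₁) := by
      calc _ ≤ 1 / K * (K * (x₂ - x₁) / ε) := by gcongr
        _ = _ := by field_simp
    simp only [hφ] at hkey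
    linarith
  · have hV1 := hM (x₀ - d) hz0 (by linarith)
    have h3 : K * d ≤ K * (x₂ - (x₀ - d)) + ε := by
      have : K * (d - ε / K) ≤ K * (x₂ - (x₀ - d)) :=
        mul_le_mul_of_nonneg_left (by linarith) hKpos.le
      rw [mul_sub, hKε] at this
      linarith
    have h4 : Real.log ε ≤ Real.log (K * d) - 2 * M * K := by
      have := Real.log_le_log hε0 hε2
      rw [Real.log_mul (by positivity) (Real.exp_pos _).ne', Real.log_exp] at this
      linarith
    have h5 := Real.log_le_log (by positivity) h3
    have h6 : 2 * M ≤ 1 / K * (Real.log (K * (x₂ - (x₀ - d)) + ε) - Real.log ε) := by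
      rw [one_div, ← div_eq_inv_mul, le_div_iff₀ hKpos]
      linarith
    simp only [hφ]
    linarith [(abs_le.1 hV1).2, (abs_le.1 hV2).1]

/-- The value function is locally Lipschitz on `[0, ∞)`. -/
theorem IsLake.exists_lipschitzOnWith (L : IsLake b c ρ r) {x₀ : ℝ} (hx₀ : 0 ≤ x₀) :
    ∃ C : NNReal, ∃ d > 0,
      LipschitzOnWith C (value b c ρ r) (Icc (x₀ - d) (x₀ + d) ∩ Ici 0) := by
  obtain ⟨C₁, d, hC₁, hd, h₁⟩ : ∃ C d, 0 ≤ C ∧ 0 < d ∧ ∀ x₁ x₂, 0 ≤ x₁ → x₀ - d ≤ x₁ →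
      x₁ ≤ x₂ → x₂ ≤ x₀ + d → value b c ρ r x₁ - value b c ρ r x₂ ≤ C * (x₂ - x₁) := by
    rcases lt_or_ge (r x₀) (b * x₀) with h | h
    · exact L.exists_sub_value_le_of_drift_neg hx₀ h
    · exact L.exists_sub_value_le_of_drift_nonneg hx₀ h
  obtain ⟨C₂, hC₂, h₂⟩ := L.exists_value_sub_le (x₀ + d)
  refine ⟨⟨C₁ + C₂, by positivity⟩, d, hd, LipschitzOnWith.of_dist_le_mul ?_⟩
  have key : ∀ x ∈ Icc (x₀ - d) (x₀ + d) ∩ Ici 0, ∀ y ∈ Icc (x₀ - d) (x₀ + d) ∩ Ici 0, x ≤ y →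
      dist (value b c ρ r x) (value b c ρ r y) ≤ (C₁ + C₂) * dist x y := by
    intro x hx y hy hxy
    have e1 := h₁ x y hx.2 hx.1.1 hxy hy.1.2
    have e2 := h₂ x y hx.2 hxy hy.1.2
    rw [dist_comm x y, Real.dist_eq, Real.dist_eq, abs_of_nonneg (sub_nonneg.2 hxy), abs_le]
    have := mul_nonneg hC₁ (sub_nonneg.2 hxy)
    have := mul_nonneg hC₂ (sub_nonneg.2 hxy)
    constructor <;> linarith
  intro x hx y hy
  rcases le_total x y with h | h
  · exact key x hx y hy h
  · rw [dist_comm, dist_comm x y]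
    exact key y hy x hx h

theorem IsLake.continuousOn_value (L : IsLake b c ρ r) :
    ContinuousOn (value b c ρ r) (Ici 0) := by
  intro x hx
  obtain ⟨C, d, hd, h⟩ := L.exists_lipschitzOnWith (mem_Ici.1 hx)
  have h1 := h.continuousOn x ⟨⟨by linarith, by linarith⟩, hx⟩
  refine h1.mono_of_mem_nhdsWithin ?_
  rw [inter_comm]
  exact inter_mem_nhdsWithin _ (Icc_mem_nhds (by linarith) (by linarith))

/-! ### The Hamilton-Jacobi-Bellman equation at points of differentiability -/

theorem IsLake.continuousAt_rate (L : IsLake b c ρ r) {z : ℝ} (hz : 0 < z) : ContinuousAt r z :=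
  L.continuousOn.continuousAt (Ici_mem_nhds hz)

/-- Take the right derivative at time 0 of the dynamic programming inequality, for motion at the
constant speed whose control starts at u. -/
theorem IsLake.le_of_hasDerivAt (L : IsLake b c ρ r) {z p u : ℝ} (hz : 0 < z)
    (h : HasDerivAt (value b c ρ r) p z) (hu : 0 < u) :
    Real.log u - c * z ^ 2 + (u + (r z - b * z)) * p ≤ ρ * value b c ρ r z := by
  set k := u - b * z + r z with hk
  set w : ℝ → ℝ := fun t => k + b * (z + k * t) - r (z + k * t) with hw
  set f : ℝ → ℝ := running c ρ w (fun t => z + k * t) with hf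
  have hrz : ContinuousAt (fun t => r (z + k * t)) 0 := by
    refine ContinuousAt.comp (f := fun t => z + k * t) ?_ (by fun_prop)
    simpa using L.continuousAt_rate hz
  have hwz : ContinuousAt w 0 := ContinuousAt.sub (by fun_prop) hrz
  have hw0 : w 0 = u := by simp only [hw, hk, mul_zero, add_zero]; ring
  have hy0 : ∀ᶠ t in 𝓝 (0 : ℝ), 0 < z + k * t := by
    have : ContinuousAt (fun t => z + k * t) 0 := by fun_prop
    exact this.eventually (lt_mem_nhds (by simpa using hz))
  have hw1 : ∀ᶠ t in 𝓝 (0 : ℝ), 0 < w t := hwz.eventually (lt_mem_nhds (by rwa [hw0]))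
  obtain ⟨d, hd, hball⟩ := Metric.eventually_nhds_iff.1 (hy0.and hw1)
  have hball' : ∀ t ∈ Ioo (-d) d, 0 < z + k * t ∧ 0 < w t := fun t ht =>
    hball (by rw [Real.dist_eq, sub_zero, abs_lt]; exact ht)
  have hwc : ContinuousOn w (Ioo (-d) d) := by
    refine ContinuousOn.sub (by fun_prop) ?_
    exact L.continuousOn.comp (by fun_prop) fun t ht => (hball' t ht).1.le
  have hfc : ContinuousOn f (Ioo (-d) d) := ContinuousOn.mul (by fun_prop)
    ((hwc.log fun t ht => (hball' t ht).2.ne').sub (by fun_prop))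
  have h0mem : (0 : ℝ) ∈ Ioo (-d) d := ⟨by linarith, hd⟩
  have hI : HasDerivAt (fun T => ∫ t in (0 : ℝ)..T, f t) (f 0) 0 :=
    intervalIntegral.integral_hasDerivAt_right (by simp)
      (hfc.stronglyMeasurableAtFilter isOpen_Ioo _ h0mem)
      (hfc.continuousAt (isOpen_Ioo.mem_nhds h0mem))
  have he : HasDerivAt (fun t : ℝ => Real.exp (-ρ * t)) (Real.exp (-ρ * 0) * (-ρ)) 0 := by
    simpa using ((hasDerivAt_id (0 : ℝ)).const_mul (-ρ)).exp
  have hlin : HasDerivAt (fun t : ℝ => z + k * t) k 0 := by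
    simpa using ((hasDerivAt_id (0 : ℝ)).const_mul k).const_add z
  have hV : HasDerivAt (fun t => value b c ρ r (z + k * t)) (p * k) 0 := by
    refine HasDerivAt.comp (h₂ := value b c ρ r) 0 ?_ hlin
    simpa using h
  have hG := hI.add (he.mul hV)
  have hle : ∀ T ∈ Ico 0 d, (∫ t in (0 : ℝ)..T, f t)
      + Real.exp (-ρ * T) * value b c ρ r (z + k * T) ≤ value b c ρ r z := by
    intro T hT
    have hsub : ∀ t ∈ Icc 0 T, t ∈ Ioo (-d) d := fun t ht =>
      ⟨by linarith [ht.1], ht.2.trans_lt hT.2⟩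
    exact L.le_value_of_linear hT.1 (fun t ht => (hball' t (hsub t ht)).1.le)
      fun t ht => (hball' t (hsub t ht)).2
  have hslope := (hasDerivAt_iff_tendsto_slope.1 hG).mono_left
    (nhdsWithin_mono (0 : ℝ) (fun t (ht : t ∈ Ioi (0 : ℝ)) => (ne_of_gt ht : t ≠ 0)))
  have hnonpos := le_of_tendsto hslope (b := 0) (by
    filter_upwards [Ioo_mem_nhdsGT hd] with T hT
    rw [slope_def_field]
    refine div_nonpos_of_nonpos_of_nonneg ?_ (by linarith [hT.1])
    have := hle T ⟨hT.1.le, hT.2⟩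
    simpa using this)
  simp only [hf, running, hw0, mul_zero, add_zero, Real.exp_zero, one_mul] at hnonpos
  rw [hk] at hnonpos
  linarith

/-- A slope `p ≥ 0` would make `log u` bounded over all `u ≥ 1` in `IsLake.le_of_hasDerivAt`. -/
theorem IsLake.neg_of_hasDerivAt (L : IsLake b c ρ r) {z p : ℝ} (hz : 0 < z)
    (h : HasDerivAt (value b c ρ r) p z) : p < 0 := by
  by_contra! hp
  have h1 : ∀ u, 1 ≤ u → Real.log u ≤ ρ * value b c ρ r z + c * z ^ 2 - (r z - b * z) * p :=
    fun u hu => by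
      have := L.le_of_hasDerivAt hz h (one_pos.trans_le hu)
      have h2 := mul_nonneg (zero_le_one.trans hu) hp
      linarith
  obtain ⟨u, hu1, hu2⟩ := ((eventually_ge_atTop 1).and (Real.tendsto_log_atTop.eventually
    (eventually_gt_atTop (ρ * value b c ρ r z + c * z ^ 2 - (r z - b * z) * p)))).exists
  exact absurd (h1 u hu1) (not_le.2 hu2)

theorem IsLake.ham_le_of_hasDerivAt (L : IsLake b c ρ r) {z p : ℝ} (hz : 0 < z)
    (h : HasDerivAt (value b c ρ r) p z) : ham b c r z p ≤ ρ * value b c ρ r z := by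
  have hp := L.neg_of_hasDerivAt hz h
  have h1 := L.le_of_hasDerivAt hz h (u := (-p)⁻¹) (inv_pos.2 (neg_pos.2 hp))
  rw [Real.log_inv, add_mul, inv_neg, neg_mul, inv_mul_cancel₀ hp.ne] at h1
  unfold ham
  linarith

theorem IsLake.continuousOn_ham (L : IsLake b c ρ r) :
    ContinuousOn (fun q : ℝ × ℝ => ham b c r q.1 q.2) (Ici 0 ×ˢ Iio 0) := by
  have h1 : ContinuousOn (fun q : ℝ × ℝ => r q.1) (Ici 0 ×ˢ Iio 0) :=
    L.continuousOn.comp continuousOn_fst fun q hq => hq.1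
  have h2 : ContinuousOn (fun q : ℝ × ℝ => Real.log (-q.2)) (Ici 0 ×ˢ Iio 0) :=
    ContinuousOn.log (by fun_prop) fun q hq => (neg_pos.2 hq.2).ne'
  have h3 : ContinuousOn (fun q : ℝ × ℝ => (r q.1 - b * q.1) * q.2) (Ici 0 ×ˢ Iio 0) :=
    (h1.sub (by fun_prop)).mul (by fun_prop)
  exact ((h3.sub h2).sub continuousOn_const).sub (by fun_prop)

/-- If the inequality failed, the tangent line bent upwards by a parabola and lowered by a small η
would be a supersolution near z. Comparison would then give `V(z) ≤ V(z) - η`. -/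
theorem IsLake.le_ham_of_hasDerivAt (L : IsLake b c ρ r) {z p : ℝ} (hz : 0 < z)
    (h : HasDerivAt (value b c ρ r) p z) : ρ * value b c ρ r z ≤ ham b c r z p := by
  have hρ := L.hρ
  have hp := L.neg_of_hasDerivAt hz h
  by_contra! hlt
  set v := value b c ρ r z with hv
  set γ := (ρ * v - ham b c r z p) / 4 with hγ
  have hγ0 : 0 < γ := by rw [hγ]; linarith
  have hcont : ContinuousAt (fun q : ℝ × ℝ => ham b c r q.1 q.2) (z, p) :=
    L.continuousOn_ham.continuousAt (prod_mem_nhds (Ici_mem_nhds hz) (Iio_mem_nhds hp))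
  have hev := (hcont.eventually (gt_mem_nhds
    (show ham b c r z p < ρ * v - 2 * γ by rw [hγ]; linarith))).and
    (prod_mem_nhds (Ici_mem_nhds hz) (Iio_mem_nhds hp) : ∀ᶠ q in 𝓝 (z, p), q ∈ Ici 0 ×ˢ Iio 0)
  obtain ⟨δ, hδ, hball⟩ := Metric.eventually_nhds_iff.1 hev
  have hball' : ∀ y q, |y - z| < δ → |q - p| < δ →
      ham b c r y q < ρ * v - 2 * γ ∧ 0 ≤ y ∧ q < 0 := by
    intro y q hy hq
    have := hball (y := (y, q)) (by
      rw [Prod.dist_eq, Real.dist_eq, Real.dist_eq]; exact max_lt hy hq)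
    exact ⟨this.1, this.2.1, this.2.2⟩
  set ε := δ / 8 with hε
  have hε0 : 0 < ε := by positivity
  have hlin := (hasDerivAt_iff_isLittleO.1 h).def hε0
  obtain ⟨d₀, hd₀, hlin⟩ := Metric.eventually_nhds_iff.1 hlin
  obtain ⟨d, hd, hdd, hdδ, hdp, hdz⟩ : ∃ d, 0 < d ∧ d < d₀ ∧ d < δ ∧ ρ * (-p * d) ≤ γ ∧ d < z := by
    have hp' : 0 < -p := neg_pos.2 hp
    refine ⟨min (min (d₀ / 2) (δ / 2)) (min (γ / (ρ * -p)) (z / 2)), by positivity, ?_, ?_, ?_, ?_⟩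
    · exact ((min_le_left _ _).trans (min_le_left _ _)).trans_lt (by linarith)
    · exact ((min_le_left _ _).trans (min_le_right _ _)).trans_lt (by linarith)
    · calc ρ * (-p * _) ≤ ρ * (-p * (γ / (ρ * -p))) := by
            gcongr
            exact (min_le_right _ _).trans (min_le_left _ _)
        _ = γ := by field_simp [hp.ne]
    · exact ((min_le_right _ _).trans (min_le_right _ _)).trans_lt (by linarith)
  set η := min (ε * d) (γ / ρ) with hη
  have hη0 : 0 < η := by positivity
  have hη1 : η ≤ ε * d := min_le_left _ _
  have hη2 : ρ * η ≤ γ := by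
    calc ρ * η ≤ ρ * (γ / ρ) := by gcongr; exact min_le_right _ _
      _ = γ := by field_simp
  -- At distance d the parabola equals `2 ε d`, which pays for the first-order error `ε d` and for
  -- `η ≤ ε d`. Its slope is at most `4 ε = δ / 2`, within the range where the strict inequality
  -- persists.
  set φ : ℝ → ℝ := fun y => v - η + p * (y - z) + 2 * ε / d * (y - z) ^ 2 with hφ
  have hsup : IsSupersolution b c ρ r (z - d) (z + d) φ (fun y => p + 4 * ε / d * (y - z)) := by
    have hin : ∀ y ∈ Icc (z - d) (z + d), |y - z| ≤ d ∧ |p + 4 * ε / d * (y - z) - p| < δ := by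
      intro y hy
      have h1 : |y - z| ≤ d := by rw [abs_le]; constructor <;> linarith [hy.1, hy.2]
      refine ⟨h1, ?_⟩
      rw [add_sub_cancel_left, abs_mul, abs_of_pos (by positivity : 0 < 4 * ε / d)]
      calc 4 * ε / d * |y - z| ≤ 4 * ε / d * d := by gcongr
        _ = δ / 2 := by rw [hε]; field_simp; norm_num
        _ < δ := by linarith
    refine ⟨fun y _ _ => ?_, by fun_prop, fun y hy _ => ?_, fun y hy _ => ?_⟩
    · have h1 := (hasDerivAt_id y).sub_const z
      refine (((h1.const_mul p).const_add (v - η)).add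
        ((h1.pow 2).const_mul (2 * ε / d))).congr_deriv ?_
      simp only [id]
      ring
    · exact (hball' y _ ((hin y hy).1.trans_lt hdδ) (hin y hy).2).2.2
    · have h1 := (hball' y _ ((hin y hy).1.trans_lt hdδ) (hin y hy).2).1
      have h2 : -(-p * d) ≤ p * (y - z) := by
        have := (abs_le.1 (hin y hy).1).2
        nlinarith
      have h3 : 0 ≤ 2 * ε / d * (y - z) ^ 2 := by positivity
      have h4 : v - η - (-p * d) ≤ φ y := by simp only [hφ]; linarith
      have h5 := mul_le_mul_of_nonneg_left h4 hρ.le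
      linarith
  have hend : ∀ y, |y - z| = d → value b c ρ r y ≤ φ y := by
    intro y hy
    have h1 := hlin (y := y) (by rw [Real.dist_eq, hy]; exact hdd)
    rw [Real.norm_eq_abs, Real.norm_eq_abs, hy, smul_eq_mul] at h1
    have h2 := (abs_le.1 h1).2
    have h3 : (y - z) ^ 2 = d ^ 2 := by rw [← sq_abs, hy]
    have h4 : 2 * ε / d * d ^ 2 = 2 * (ε * d) := by field_simp
    simp only [hφ, h3, h4]
    linarith
  have := L.value_le_of_isSupersolution hsup
    (fun _ => hend _ (by rw [sub_sub_cancel_left, abs_neg, abs_of_pos hd]))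
    (hend _ (by rw [add_sub_cancel_left, abs_of_pos hd])) (x := z)
    ⟨by linarith, by linarith⟩ hz.le
  simp only [hφ, sub_self] at this
  rw [← hv] at this
  linarith

/-- The Hamilton-Jacobi-Bellman equation at points of differentiability. -/
theorem IsLake.hjb (L : IsLake b c ρ r) {z p : ℝ} (hz : 0 < z)
    (h : HasDerivAt (value b c ρ r) p z) :
    p < 0 ∧ ham b c r z p = ρ * value b c ρ r z :=
  ⟨L.neg_of_hasDerivAt hz h, le_antisymm (L.ham_le_of_hasDerivAt hz h)
    (L.le_ham_of_hasDerivAt hz h)⟩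

/-! ### Absence of concave kinks -/

theorem exists_gt_of_hasDerivAt_pos {f : ℝ → ℝ} {f' z₁ z₂ : ℝ} (h : HasDerivAt f f' z₁)
    (hf : 0 < f') (hz : z₁ < z₂) : ∃ y ∈ Ioo z₁ z₂, f z₁ < f y := by
  have hslope := (hasDerivAt_iff_tendsto_slope.1 h).mono_left
    (nhdsWithin_mono z₁ (fun t (ht : t ∈ Ioi z₁) => (ne_of_gt ht : t ≠ z₁)))
  obtain ⟨y, hy1, hy2⟩ := ((hslope.eventually (lt_mem_nhds hf)).and (Ioo_mem_nhdsGT hz)).exists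
  refine ⟨y, hy2, ?_⟩
  rw [slope_def_field] at hy1
  have := (div_pos_iff_of_pos_right (sub_pos.2 hy2.1)).1 hy1
  linarith

theorem exists_gt_of_hasDerivAt_neg {f : ℝ → ℝ} {f' z₁ z₂ : ℝ} (h : HasDerivAt f f' z₂)
    (hf : f' < 0) (hz : z₁ < z₂) : ∃ y ∈ Ioo z₁ z₂, f z₂ < f y := by
  have h' : HasDerivAt (fun y => f (-y)) (-f') (-z₂) := by
    have := HasDerivAt.comp (-z₂) (h₂ := f) (by simpa using h) (hasDerivAt_neg (-z₂))
    simpa using! this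
  obtain ⟨y, hy, hlt⟩ := exists_gt_of_hasDerivAt_pos h' (by linarith) (neg_lt_neg hz)
  refine ⟨-y, ⟨by linarith [hy.2], by linarith [hy.1]⟩, by simpa using hlt⟩

/-- The function `V - q x` has no interior peak over an interval on which the Hamiltonian at `q`
lies below `ρ V`. -/
theorem IsLake.not_peak (L : IsLake b c ρ r) {q z₁ z₂ y₀ : ℝ} (hq : q < 0)
    (hz₁ : 0 ≤ z₁) (hy₀ : y₀ ∈ Icc z₁ z₂)
    (hham : ∀ y ∈ Icc z₁ z₂, ham b c r y q < ρ * value b c ρ r y)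
    (h₁ : value b c ρ r z₁ - q * z₁ < value b c ρ r y₀ - q * y₀)
    (h₂ : value b c ρ r z₂ - q * z₂ < value b c ρ r y₀ - q * y₀) : False := by
  have hρ := L.hρ
  set f : ℝ → ℝ := fun y => value b c ρ r y - q * y with hf
  have hsub : Icc z₁ z₂ ⊆ Ici 0 := fun y hy => hz₁.trans hy.1
  have hVc := L.continuousOn_value.mono hsub
  have hfc : ContinuousOn f (Icc z₁ z₂) := hVc.sub (by fun_prop)
  have hne : (Icc z₁ z₂).Nonempty := ⟨y₀, hy₀⟩
  have hlin : ∀ z, HasDerivAt (fun y : ℝ => q * y) q z := fun z => by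
    simpa using (hasDerivAt_id z).const_mul q
  obtain ⟨m, hm, hmax⟩ := isCompact_Icc.exists_isMaxOn hne hfc
  have hm1 : f z₁ < f m := lt_of_lt_of_le h₁ (hmax hy₀)
  have hm2 : f z₂ < f m := lt_of_lt_of_le h₂ (hmax hy₀)
  have hhc : ContinuousOn (fun y => ham b c r y q) (Icc z₁ z₂) :=
    L.continuousOn_ham.comp (f := fun y => (y, q)) (by fun_prop) fun y hy => ⟨hsub hy, hq⟩
  obtain ⟨m', hm', hmin⟩ := isCompact_Icc.exists_isMinOn hne
    ((hVc.const_smul ρ).sub hhc)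
  set γ := ρ * value b c ρ r m' - ham b c r m' q with hγ
  have hγ0 : 0 < γ := sub_pos.2 (hham m' hm')
  have hγle : ∀ y ∈ Icc z₁ z₂, ham b c r y q ≤ ρ * value b c ρ r y - γ := fun y hy => by
    have h3 : γ ≤ ρ * value b c ρ r y - ham b c r y q := hmin hy
    linarith
  set η := min (min (f m - f z₁) (f m - f z₂)) (γ / ρ) with hη
  have hη0 : 0 < η := lt_min (lt_min (by linarith) (by linarith)) (by positivity)
  have hη1 : η ≤ f m - f z₁ := (min_le_left _ _).trans (min_le_left _ _)
  have hη2 : η ≤ f m - f z₂ := (min_le_left _ _).trans (min_le_right _ _)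
  have hη3 : ρ * η ≤ γ := by
    calc ρ * η ≤ ρ * (γ / ρ) := by gcongr; exact min_le_right _ _
      _ = γ := by field_simp
  -- The line of slope q passing η below the graph of V at the peak m still dominates V at both
  -- ends, and the gap `γ ≥ ρ η` makes it a supersolution. Comparison at m is then contradictory.
  have hsup : IsSupersolution b c ρ r z₁ z₂ (fun y => f m - η + q * y) (fun _ => q) := by
    refine ⟨fun y _ _ => (hlin y).const_add _, continuousOn_const, fun _ _ _ => hq,
      fun y hy _ => ?_⟩
    have h3 : f y ≤ f m := hmax hy
    have h4 : value b c ρ r y - η ≤ f m - η + q * y := by simp only [hf] at h3 ⊢; linarith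
    have h5 := mul_le_mul_of_nonneg_left h4 hρ.le
    have h6 := hγle y hy
    linarith
  have := L.value_le_of_isSupersolution hsup
    (fun _ => by simp only [hf] at hη1 ⊢; linarith) (by simp only [hf] at hη2 ⊢; linarith)
    (x := m) hm (hsub hm)
  simp only [hf] at this
  linarith

/-- The value function has no concave kinks: its slope cannot drop through a value `q` at which
the Hamiltonian lies below `ρ V`. -/
theorem IsLake.not_slope_drop (L : IsLake b c ρ r) {q z₁ z₂ p₁ p₂ : ℝ} (hq : q < 0)
    (hz₁ : 0 ≤ z₁) (hz : z₁ < z₂)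
    (hham : ∀ y ∈ Icc z₁ z₂, ham b c r y q < ρ * value b c ρ r y)
    (h₁ : HasDerivAt (value b c ρ r) p₁ z₁) (h₂ : HasDerivAt (value b c ρ r) p₂ z₂)
    (hp₁ : q < p₁) (hp₂ : p₂ < q) : False := by
  have hlin : ∀ z, HasDerivAt (fun y : ℝ => q * y) q z := fun z => by
    simpa using (hasDerivAt_id z).const_mul q
  obtain ⟨y₁, hy₁, hlt₁⟩ := exists_gt_of_hasDerivAt_pos (h₁.sub (hlin z₁)) (by linarith) hz
  obtain ⟨y₂, hy₂, hlt₂⟩ := exists_gt_of_hasDerivAt_neg (h₂.sub (hlin z₂)) (by linarith) hz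
  simp only [Pi.sub_apply] at hlt₁ hlt₂
  rcases le_total (value b c ρ r y₁ - q * y₁) (value b c ρ r y₂ - q * y₂) with h | h
  · exact L.not_peak hq hz₁ (Ioo_subset_Icc_self hy₂) hham (hlt₁.trans_le h) hlt₂
  · exact L.not_peak hq hz₁ (Ioo_subset_Icc_self hy₁) hham hlt₁ (hlt₂.trans_le h)

/-! ### Limits of slopes -/

theorem sub_mem_Icc_of_deriv_mem {f : ℝ → ℝ} {s t k₁ k₂ : ℝ} (hst : s ≤ t)
    (hf : AbsolutelyContinuousOnInterval f s t)
    (h : ∀ z ∈ Ioo s t, DifferentiableAt ℝ f z → deriv f z ∈ Icc k₁ k₂) :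
    f t - f s ∈ Icc (k₁ * (t - s)) (k₂ * (t - s)) := by
  have hae : ∀ᵐ z, z ∈ Icc s t → deriv f z ∈ Icc k₁ k₂ := by
    have h1 : ∀ᵐ z : ℝ, z ≠ s := by simp [ae_iff, measure_singleton]
    have h2 : ∀ᵐ z : ℝ, z ≠ t := by simp [ae_iff, measure_singleton]
    filter_upwards [hf.ae_differentiableAt, h1, h2] with z hz hs ht hzI
    exact h z ⟨lt_of_le_of_ne hzI.1 (Ne.symm hs), lt_of_le_of_ne hzI.2 ht⟩
      (hz (by rwa [uIcc_of_le hst]))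
  have hconst : ∀ k : ℝ, ∫ _ in s..t, k = k * (t - s) := fun k => by
    rw [intervalIntegral.integral_const, smul_eq_mul, mul_comm]
  rw [← hf.integral_deriv_eq_sub, ← hconst k₁, ← hconst k₂]
  constructor
  · refine intervalIntegral.integral_mono_ae_restrict hst intervalIntegrable_const
      hf.intervalIntegrable_deriv ?_
    rw [EventuallyLE, ae_restrict_iff' measurableSet_Icc]
    filter_upwards [hae] with z hz hzI using (hz hzI).1
  · refine intervalIntegral.integral_mono_ae_restrict hst hf.intervalIntegrable_deriv
      intervalIntegrable_const ?_
    rw [EventuallyLE, ae_restrict_iff' measurableSet_Icc]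
    filter_upwards [hae] with z hz hzI using (hz hzI).2

/-- A locally Lipschitz function is differentiable at a point where its almost everywhere defined
derivative has a limit. -/
theorem hasDerivWithinAt_of_tendsto_deriv_of_lipschitz {f : ℝ → ℝ} {S U : Set ℝ}
    (hS : S.OrdConnected) {x₀ p : ℝ} (hx₀ : x₀ ∈ S) {C : NNReal} (hU : U ∈ 𝓝 x₀)
    (hf : LipschitzOnWith C f (U ∩ S)) {E : Set ℝ}
    (hE : ∀ z ∈ interior S, DifferentiableAt ℝ f z → z ∈ E)
    (h : Tendsto (deriv f) (𝓝[(S \ {x₀}) ∩ E] x₀) (𝓝 p)) : HasDerivWithinAt f p S x₀ := by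
  rw [hasDerivWithinAt_iff_isLittleO, Asymptotics.isLittleO_iff]
  intro ε hε
  have h1 := h.eventually (Icc_mem_nhds (show p - ε < p by linarith) (show p < p + ε by linarith))
  rw [eventually_nhdsWithin_iff] at h1
  obtain ⟨d, hd, hball⟩ := Metric.eventually_nhds_iff.1 (h1.and hU)
  rw [eventually_nhdsWithin_iff, Metric.eventually_nhds_iff]
  refine ⟨d, hd, fun y hyd hyS => ?_⟩
  rw [Real.dist_eq, abs_lt] at hyd
  have key : ∀ s t, s ∈ S → t ∈ S → s ≤ t → (∀ z ∈ Icc s t, dist z x₀ < d) →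
      x₀ ∉ Ioo s t → f t - f s ∈ Icc ((p - ε) * (t - s)) ((p + ε) * (t - s)) := by
    intro s t hs ht hst hdist hx
    have hsub : Icc s t ⊆ S := hS.out hs ht
    refine sub_mem_Icc_of_deriv_mem hst ?_ fun z hz hdiff => ?_
    · refine (hf.mono ?_).absolutelyContinuousOnInterval
      rw [uIcc_of_le hst]
      exact fun z hz => ⟨(hball (hdist z hz)).2, hsub hz⟩
    · refine (hball (hdist z (Ioo_subset_Icc_self hz))).1
        ⟨⟨hsub (Ioo_subset_Icc_self hz), fun h => hx (h ▸ hz)⟩, hE z ?_ hdiff⟩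
      exact interior_mono hsub (by rwa [interior_Icc])
  rw [Real.norm_eq_abs, Real.norm_eq_abs, smul_eq_mul]
  rcases le_total x₀ y with hy | hy
  · have := key x₀ y hx₀ hyS hy (fun z hz => by
      rw [Real.dist_eq, abs_lt]; constructor <;> linarith [hz.1, hz.2]) (fun h => lt_irrefl _ h.1)
    rw [abs_of_nonneg (sub_nonneg.2 hy), abs_le]
    constructor <;> linarith [this.1, this.2]
  · have := key y x₀ hyS hx₀ hy (fun z hz => by
      rw [Real.dist_eq, abs_lt]; constructor <;> linarith [hz.1, hz.2]) (fun h => lt_irrefl _ h.2)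
    rw [abs_of_nonpos (sub_nonpos.2 hy), abs_le]
    constructor <;> linarith [this.1, this.2]

/-- The interior points of the state space at which the value function is differentiable. -/
def diffSet (b c ρ : ℝ) (r : ℝ → ℝ) : Set ℝ :=
  {z | 0 < z ∧ DifferentiableAt ℝ (value b c ρ r) z}

theorem IsLake.root_of_tendsto (L : IsLake b c ρ r) {x₀ p : ℝ} (hx₀ : 0 ≤ x₀) {U : Filter ℝ}
    [U.NeBot] (hU : U ≤ 𝓝[diffSet b c ρ r] x₀)
    (h : Tendsto (deriv (value b c ρ r)) U (𝓝 p)) :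
    p < 0 ∧ ham b c r x₀ p = ρ * value b c ρ r x₀ := by
  have hle : 𝓝[diffSet b c ρ r] x₀ ≤ 𝓝[Ici 0] x₀ := nhdsWithin_mono _ fun z hz => hz.1.le
  have hV : Tendsto (value b c ρ r) U (𝓝 (value b c ρ r x₀)) :=
    (L.continuousOn_value x₀ hx₀).mono_left (hU.trans hle)
  have hr : Tendsto r U (𝓝 (r x₀)) := (L.continuousOn x₀ hx₀).mono_left (hU.trans hle)
  have hid : Tendsto (fun z : ℝ => z) U (𝓝 x₀) := hU.trans nhdsWithin_le_nhds
  have hE : ∀ᶠ z in U, z ∈ diffSet b c ρ r := hU self_mem_nhdsWithin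
  have hlim : Tendsto (fun z => Real.exp ((r z - b * z) * deriv (value b c ρ r) z - 1 - c * z ^ 2
      - ρ * value b c ρ r z)) U (𝓝 (Real.exp ((r x₀ - b * x₀) * p - 1 - c * x₀ ^ 2
      - ρ * value b c ρ r x₀))) :=
    (Real.continuous_exp.tendsto _).comp (((((hr.sub (hid.const_mul b)).mul h).sub_const 1).sub
      ((hid.pow 2).const_mul c)).sub (hV.const_mul ρ))
  -- Passing to the limit in the exponentiated equation avoids the singularity of the logarithm and
  -- shows that the limit p cannot be 0.
  have heq : -p = Real.exp ((r x₀ - b * x₀) * p - 1 - c * x₀ ^ 2 - ρ * value b c ρ r x₀) := by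
    refine tendsto_nhds_unique h.neg (hlim.congr' ?_)
    filter_upwards [hE] with z hz
    obtain ⟨h1, h2⟩ := L.hjb hz.1 hz.2.hasDerivAt
    rw [← h2]
    unfold ham
    rw [show ∀ A B C D : ℝ, A - C - D - (A - B - C - D) = B by intros; ring,
      Real.exp_log (neg_pos.2 h1)]
  have hp : 0 < -p := heq ▸ Real.exp_pos _
  refine ⟨by linarith, ?_⟩
  have := congrArg Real.log heq
  rw [Real.log_exp] at this
  unfold ham
  linarith

/-! ### Branches of the Hamilton-Jacobi-Bellman equation -/

/-- The tangent inequality for the convex function `p ↦ H(x, p)`. -/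
theorem ham_tangent_le {x p q : ℝ} (hp : p < 0) (hq : q < 0) :
    ham b c r x p + (r x - b * x - 1 / p) * (q - p) ≤ ham b c r x q := by
  have h1 : 0 < -q / -p := div_pos (neg_pos.2 hq) (neg_pos.2 hp)
  have h := Real.log_le_sub_one_of_pos h1
  rw [Real.log_div (neg_pos.2 hq).ne' (neg_pos.2 hp).ne', neg_div_neg_eq] at h
  have h2 : 1 / p * (q - p) = q / p - 1 := by field_simp [hp.ne]
  unfold ham
  rw [sub_mul (r x - b * x) (1 / p), h2]
  linarith

theorem ham_tangent_lt {x p q : ℝ} (hp : p < 0) (hq : q < 0) (hpq : q ≠ p) :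
    ham b c r x p + (r x - b * x - 1 / p) * (q - p) < ham b c r x q := by
  have h1 : 0 < -q / -p := div_pos (neg_pos.2 hq) (neg_pos.2 hp)
  have h := Real.log_lt_sub_one_of_pos h1 (by
    rw [neg_div_neg_eq, Ne, div_eq_one_iff_eq hp.ne]; exact hpq)
  rw [Real.log_div (neg_pos.2 hq).ne' (neg_pos.2 hp).ne', neg_div_neg_eq] at h
  have h2 : 1 / p * (q - p) = q / p - 1 := by field_simp [hp.ne]
  unfold ham
  rw [sub_mul (r x - b * x) (1 / p), h2]
  linarith

/-- The drift is the derivative of the Hamiltonian in p, and a convex function with a smaller value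
further left is increasing at p. -/
theorem drift_pos_of_ham_lt {x p q : ℝ} (hp : p < 0) (hq : q < 0) (hqp : q < p)
    (h : ham b c r x q < ham b c r x p) : 0 < r x - b * x - 1 / p := by
  have := ham_tangent_le (b := b) (c := c) (r := r) (x := x) hp hq
  by_contra! hn
  have := mul_nonneg_of_nonpos_of_nonpos hn (by linarith : q - p ≤ 0)
  linarith

theorem drift_neg_of_ham_lt {x p q : ℝ} (hp : p < 0) (hq : q < 0) (hqp : p < q)
    (h : ham b c r x q < ham b c r x p) : r x - b * x - 1 / p < 0 := by
  have := ham_tangent_le (b := b) (c := c) (r := r) (x := x) hp hq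
  by_contra! hn
  have := mul_nonneg hn (by linarith : 0 ≤ q - p)
  linarith

/-- A convex function is injective where its derivative is positive; the tangent inequalities at the
two points exclude either order. -/
theorem eq_of_ham_eq_of_drift_pos {x p₁ p₂ : ℝ} (hp₁ : p₁ < 0) (hp₂ : p₂ < 0)
    (h₁ : 0 < r x - b * x - 1 / p₁) (h₂ : 0 < r x - b * x - 1 / p₂)
    (h : ham b c r x p₁ = ham b c r x p₂) : p₁ = p₂ := by
  have e1 := ham_tangent_le (b := b) (c := c) (r := r) (x := x) hp₁ hp₂
  have e2 := ham_tangent_le (b := b) (c := c) (r := r) (x := x) hp₂ hp₁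
  have e3 : p₂ - p₁ ≤ 0 := by by_contra! hn; have := mul_pos h₁ hn; linarith
  have e4 : p₁ - p₂ ≤ 0 := by by_contra! hn; have := mul_pos h₂ hn; linarith
  linarith

theorem eq_of_ham_eq_of_drift_neg {x p₁ p₂ : ℝ} (hp₁ : p₁ < 0) (hp₂ : p₂ < 0)
    (h₁ : r x - b * x - 1 / p₁ < 0) (h₂ : r x - b * x - 1 / p₂ < 0)
    (h : ham b c r x p₁ = ham b c r x p₂) : p₁ = p₂ := by
  have e1 := ham_tangent_le (b := b) (c := c) (r := r) (x := x) hp₁ hp₂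
  have e2 := ham_tangent_le (b := b) (c := c) (r := r) (x := x) hp₂ hp₁
  have e3 : 0 ≤ p₂ - p₁ := by by_contra! hn; have := mul_pos_of_neg_of_neg h₁ hn; linarith
  have e4 : 0 ≤ p₁ - p₂ := by by_contra! hn; have := mul_pos_of_neg_of_neg h₂ hn; linarith
  linarith

theorem IsLake.eventually_abs_deriv_le (L : IsLake b c ρ r) {x₀ : ℝ} (hx₀ : 0 ≤ x₀) :
    ∃ C : ℝ, ∀ᶠ z in 𝓝 x₀, 0 < z → deriv (value b c ρ r) z ∈ Icc (-C) C := by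
  obtain ⟨C, d, hd, h⟩ := L.exists_lipschitzOnWith hx₀
  refine ⟨C, ?_⟩
  filter_upwards [Ioo_mem_nhds (show x₀ - d < x₀ by linarith) (show x₀ < x₀ + d by linarith)]
    with z hz hz0
  have := norm_deriv_le_of_lipschitzOn
    (inter_mem (Icc_mem_nhds hz.1 hz.2) (Ici_mem_nhds hz0)) h
  exact abs_le.1 this

/-- If the derivatives of `V` have at most one limit point at `x₀` from within `S`, then `V` has a
derivative at `x₀` within `S`, and it is the limit of the derivatives. -/
theorem IsLake.hasDerivWithinAt_of_unique (L : IsLake b c ρ r) {S : Set ℝ} (hS : S.OrdConnected)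
    (hS0 : S ⊆ Ici 0) {x₀ p : ℝ} (hx₀ : x₀ ∈ S)
    (h : ∀ p', MapClusterPt p' (𝓝[(S \ {x₀}) ∩ diffSet b c ρ r] x₀) (deriv (value b c ρ r)) →
      p' = p) :
    HasDerivWithinAt (value b c ρ r) p S x₀ ∧
    Tendsto (deriv (value b c ρ r)) (𝓝[(S \ {x₀}) ∩ diffSet b c ρ r] x₀) (𝓝 p) := by
  obtain ⟨C, hC⟩ := L.eventually_abs_deriv_le (hS0 hx₀)
  have htend : Tendsto (deriv (value b c ρ r)) (𝓝[(S \ {x₀}) ∩ diffSet b c ρ r] x₀) (𝓝 p) := by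
    refine isCompact_Icc.le_nhds_of_unique_clusterPt (s := Icc (-C) C) ?_ fun p' _ hp' => h p' hp'
    rw [mem_map]
    filter_upwards [nhdsWithin_le_nhds hC, self_mem_nhdsWithin] with z hz hzE using hz hzE.2.1
  obtain ⟨K, d, hd, hlip⟩ := L.exists_lipschitzOnWith (hS0 hx₀)
  refine ⟨hasDerivWithinAt_of_tendsto_deriv_of_lipschitz hS hx₀
    (Icc_mem_nhds (show x₀ - d < x₀ by linarith) (show x₀ < x₀ + d by linarith))
    (hlip.mono (inter_subset_inter_right _ hS0)) (fun z hz hd => ?_) htend, htend⟩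
  have := interior_mono hS0 hz
  rw [interior_Ici] at this
  exact ⟨this, hd⟩

/-- A part of the state space on which the slope of `V` stays on one branch of the
Hamilton-Jacobi-Bellman equation. -/
structure IsBranch (b c ρ : ℝ) (r : ℝ → ℝ) (S : Set ℝ) (q : ℝ) : Prop where
  ordConnected : S.OrdConnected
  subset : S ⊆ Ici 0
  neg : q < 0
  ham_lt : ∀ z ∈ S, ham b c r z q < ρ * value b c ρ r z
  side : (∀ z ∈ S, z ∈ diffSet b c ρ r → q < deriv (value b c ρ r) z) ∨
    (∀ z ∈ S, z ∈ diffSet b c ρ r → deriv (value b c ρ r) z < q)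

/-- A limit slope is a root of the equation and q lies strictly below the level, so the side of q
fixes the sign of the drift. With an arbitrary filter U this covers limits of slopes as well as,
with `pure z`, the slope at z itself. -/
theorem IsBranch.drift (L : IsLake b c ρ r) {S : Set ℝ} {q : ℝ} (h : IsBranch b c ρ r S q) :
    (∀ x₀ ∈ S, ∀ p, ∀ U : Filter ℝ, U.NeBot → U ≤ 𝓝[S ∩ diffSet b c ρ r] x₀ →
      Tendsto (deriv (value b c ρ r)) U (𝓝 p) → 0 < r x₀ - b * x₀ - 1 / p) ∨
    (∀ x₀ ∈ S, ∀ p, ∀ U : Filter ℝ, U.NeBot → U ≤ 𝓝[S ∩ diffSet b c ρ r] x₀ →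
      Tendsto (deriv (value b c ρ r)) U (𝓝 p) → r x₀ - b * x₀ - 1 / p < 0) := by
  have hroot : ∀ x₀ ∈ S, ∀ p, ∀ U : Filter ℝ, U.NeBot → U ≤ 𝓝[S ∩ diffSet b c ρ r] x₀ →
      Tendsto (deriv (value b c ρ r)) U (𝓝 p) →
      p < 0 ∧ ham b c r x₀ q < ham b c r x₀ p := by
    intro x₀ hx₀ p U hU hle ht
    obtain ⟨h1, h2⟩ := L.root_of_tendsto (h.subset hx₀)
      (hle.trans (nhdsWithin_mono _ inter_subset_right)) ht
    exact ⟨h1, h2 ▸ h.ham_lt x₀ hx₀⟩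
  have hev : ∀ {x₀ : ℝ} {U : Filter ℝ}, U ≤ 𝓝[S ∩ diffSet b c ρ r] x₀ →
      ∀ᶠ z in U, z ∈ S ∩ diffSet b c ρ r := fun hle => hle self_mem_nhdsWithin
  rcases h.side with hs | hs
  · left
    intro x₀ hx₀ p U hU hle ht
    obtain ⟨h1, h2⟩ := hroot x₀ hx₀ p U hU hle ht
    have hqp : q ≤ p := ge_of_tendsto ht ((hev hle).mono fun z hz => (hs z hz.1 hz.2).le)
    exact drift_pos_of_ham_lt h1 h.neg (lt_of_le_of_ne hqp fun he => by rw [he] at h2; simp at h2) h2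
  · right
    intro x₀ hx₀ p U hU hle ht
    obtain ⟨h1, h2⟩ := hroot x₀ hx₀ p U hU hle ht
    have hqp : p ≤ q := le_of_tendsto ht ((hev hle).mono fun z hz => (hs z hz.1 hz.2).le)
    exact drift_neg_of_ham_lt h1 h.neg (lt_of_le_of_ne hqp fun he => by rw [he] at h2; simp at h2) h2

theorem IsBranch.drift_ne_zero (L : IsLake b c ρ r) {S : Set ℝ} {q : ℝ}
    (h : IsBranch b c ρ r S q) {x₀ p : ℝ} (hx₀ : x₀ ∈ S) {U : Filter ℝ} [hU : U.NeBot]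
    (hle : U ≤ 𝓝[S ∩ diffSet b c ρ r] x₀) (ht : Tendsto (deriv (value b c ρ r)) U (𝓝 p)) :
    r x₀ - b * x₀ - 1 / p ≠ 0 := by
  rcases h.drift L with hd | hd
  · exact (hd x₀ hx₀ p U hU hle ht).ne'
  · exact (hd x₀ hx₀ p U hU hle ht).ne

/-- All limit slopes at x₀ are roots with drift of the same sign, hence they coincide. -/
theorem IsBranch.exists_hasDerivWithinAt (L : IsLake b c ρ r) {S : Set ℝ} {q : ℝ}
    (h : IsBranch b c ρ r S q) {x₀ : ℝ} (hx₀ : x₀ ∈ S) :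
    ∃ p, HasDerivWithinAt (value b c ρ r) p S x₀ ∧
      Tendsto (deriv (value b c ρ r)) (𝓝[(S \ {x₀}) ∩ diffSet b c ρ r] x₀) (𝓝 p) := by
  have hle : 𝓝[(S \ {x₀}) ∩ diffSet b c ρ r] x₀ ≤ 𝓝[S ∩ diffSet b c ρ r] x₀ :=
    nhdsWithin_mono _ (inter_subset_inter_left _ sdiff_subset)
  have hle2 : 𝓝[S ∩ diffSet b c ρ r] x₀ ≤ 𝓝[diffSet b c ρ r] x₀ :=
    nhdsWithin_mono _ inter_subset_right
  have huniq : ∀ p₁ p₂,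
      MapClusterPt p₁ (𝓝[(S \ {x₀}) ∩ diffSet b c ρ r] x₀) (deriv (value b c ρ r)) →
      MapClusterPt p₂ (𝓝[(S \ {x₀}) ∩ diffSet b c ρ r] x₀) (deriv (value b c ρ r)) →
      p₁ = p₂ := by
    intro p₁ p₂ h₁ h₂
    obtain ⟨U₁, hU₁, ht₁⟩ := mapClusterPt_iff_ultrafilter.1 h₁
    obtain ⟨U₂, hU₂, ht₂⟩ := mapClusterPt_iff_ultrafilter.1 h₂
    have l₁ := hU₁.trans hle
    have l₂ := hU₂.trans hle
    obtain ⟨e₁, e₁'⟩ := L.root_of_tendsto (h.subset hx₀) (l₁.trans hle2) ht₁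
    obtain ⟨e₂, e₂'⟩ := L.root_of_tendsto (h.subset hx₀) (l₂.trans hle2) ht₂
    rcases h.drift L with hd | hd
    · exact eq_of_ham_eq_of_drift_pos e₁ e₂ (hd x₀ hx₀ p₁ U₁ inferInstance l₁ ht₁)
        (hd x₀ hx₀ p₂ U₂ inferInstance l₂ ht₂) (e₁'.trans e₂'.symm)
    · exact eq_of_ham_eq_of_drift_neg e₁ e₂ (hd x₀ hx₀ p₁ U₁ inferInstance l₁ ht₁)
        (hd x₀ hx₀ p₂ U₂ inferInstance l₂ ht₂) (e₁'.trans e₂'.symm)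
  by_cases hex : ∃ p,
      MapClusterPt p (𝓝[(S \ {x₀}) ∩ diffSet b c ρ r] x₀) (deriv (value b c ρ r))
  · obtain ⟨p, hp⟩ := hex
    exact ⟨p, L.hasDerivWithinAt_of_unique h.ordConnected h.subset hx₀ fun p' hp' =>
      huniq p' p hp' hp⟩
  -- Without any limit point uniqueness is vacuous and an arbitrary number serves as p; this covers
  -- an isolated point of S.
  · exact ⟨0, L.hasDerivWithinAt_of_unique h.ordConnected h.subset hx₀ fun p' hp' =>
      absurd ⟨p', hp'⟩ hex⟩

theorem IsBranch.interior_subset_diffSet (L : IsLake b c ρ r) {S : Set ℝ} {q : ℝ}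
    (h : IsBranch b c ρ r S q) : interior S ⊆ diffSet b c ρ r := by
  intro z hz
  obtain ⟨p, hp, -⟩ := h.exists_hasDerivWithinAt L (interior_subset hz)
  have h0 := interior_mono h.subset hz
  rw [interior_Ici] at h0
  exact ⟨h0, (hp.hasDerivAt (mem_interior_iff_mem_nhds.1 hz)).differentiableAt⟩

/-! ### Second derivatives along a branch -/

/-- Differentiating the equation `H(x, g(x)) = ρ V(x)` where `H` has nonzero drift. -/
theorem hasDerivWithinAt_of_ham_eq {V g : ℝ → ℝ} {S : Set ℝ} {x₀ r' : ℝ} (hx₀ : x₀ ∈ S)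
    (hg : ContinuousWithinAt g S x₀) (hV : HasDerivWithinAt V (g x₀) S x₀)
    (hr : HasDerivWithinAt r r' S x₀) (hneg : ∀ᶠ z in 𝓝[S] x₀, g z < 0)
    (hham : ∀ᶠ z in 𝓝[S] x₀, ham b c r z (g z) = ρ * V z)
    (hdrift : r x₀ - b * x₀ - 1 / g x₀ ≠ 0) :
    HasDerivWithinAt g (((ρ + b - r') * g x₀ + 2 * c * x₀) / (r x₀ - b * x₀ - 1 / g x₀)) S x₀ := by
  have hg0 : g x₀ < 0 := hneg.self_of_nhdsWithin hx₀
  have hham0 : ham b c r x₀ (g x₀) = ρ * V x₀ := hham.self_of_nhdsWithin hx₀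
  set ℓ : ℝ → ℝ := fun p => Real.log (-p) with hℓ
  have hℓd : HasDerivAt ℓ (1 / g x₀) (g x₀) := by
    have := (hasDerivAt_neg (g x₀)).log (neg_pos.2 hg0).ne'
    rwa [neg_div_neg_eq] at this
  -- The difference quotient of the logarithm, continuous at `g x₀`, makes the increment of the
  -- equation linear in `g z - g x₀`. Its coefficient tends to the nonzero drift, so mere continuity
  -- of g suffices to solve for the slope of g.
  set Λ := dslope ℓ (g x₀) with hΛ
  have hΛc : Tendsto (fun z => Λ (g z)) (𝓝[S] x₀) (𝓝 (1 / g x₀)) := by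
    have h1 : ContinuousAt Λ (g x₀) := continuousAt_dslope_same.2 hℓd.differentiableAt
    have h2 : Λ (g x₀) = 1 / g x₀ := by rw [hΛ, dslope_same, hℓd.deriv]
    have := h1.tendsto.comp hg
    rwa [h2] at this
  set W : ℝ → ℝ := fun z => ρ * V z + 1 + c * z ^ 2 with hW
  set m : ℝ → ℝ := fun z => r z - b * z with hm
  have hid := hasDerivWithinAt_id x₀ S
  have hWd : HasDerivWithinAt W (ρ * g x₀ + 2 * c * x₀) S x₀ := by
    refine (((hV.const_mul ρ).add_const 1).add ((hid.pow 2).const_mul c)).congr_deriv ?_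
    simp only [id]
    ring
  have hmd : HasDerivWithinAt m (r' - b) S x₀ := by
    refine (hr.sub (hid.const_mul b)).congr_deriv ?_
    ring
  rw [hasDerivWithinAt_iff_tendsto_slope] at hWd hmd ⊢
  have hle : 𝓝[S \ {x₀}] x₀ ≤ 𝓝[S] x₀ := nhdsWithin_mono _ sdiff_subset
  have hden : Tendsto (fun z => m x₀ - Λ (g z)) (𝓝[S \ {x₀}] x₀) (𝓝 (m x₀ - 1 / g x₀)) :=
    (hΛc.mono_left hle).const_sub _
  have hnum := hWd.sub (hmd.mul (hg.mono_left hle))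
  have hlim := hnum.div hden hdrift
  have hval : (ρ * g x₀ + 2 * c * x₀ - (r' - b) * g x₀) / (m x₀ - 1 / g x₀) =
      ((ρ + b - r') * g x₀ + 2 * c * x₀) / (r x₀ - b * x₀ - 1 / g x₀) := by
    simp only [hm]; congr 1; ring
  rw [hval] at hlim
  refine hlim.congr' ?_
  filter_upwards [hle hham, hden.eventually_ne hdrift, self_mem_nhdsWithin] with z hz hne hzS
  have hzx : z - x₀ ≠ 0 := sub_ne_zero.2 hzS.2
  have h1 : (g z - g x₀) * Λ (g z) = ℓ (g z) - ℓ (g x₀) := by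
    have := sub_smul_dslope ℓ (g x₀) (g z)
    rwa [smul_eq_mul] at this
  have h2 : (g z - g x₀) * (m x₀ - Λ (g z)) = W z - W x₀ - (m z - m x₀) * g z := by
    unfold ham at hz hham0
    simp only [hW, hm, hℓ] at h1 ⊢
    linarith
  simp only [Pi.div_apply, slope_def_field]
  rw [div_eq_iff hne]
  field_simp
  linarith

/-- The value of `V''(x)` obtained by differentiating the Hamilton-Jacobi-Bellman equation, in
terms of `x` and `p = V'(x)`. -/
noncomputable def secondFormula (b c ρ : ℝ) (r : ℝ → ℝ) (x p : ℝ) : ℝ :=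
  ((ρ + b - derivWithin r (Ici 0) x) * p + 2 * c * x) / (r x - b * x - 1 / p)

theorem IsLake.hasDerivWithinAt_rate (L : IsLake b c ρ r) {x : ℝ} (hx : 0 ≤ x) :
    HasDerivWithinAt r (derivWithin r (Ici 0) x) (Ici 0) x :=
  (L.rate.contDiffOn.differentiableOn one_ne_zero x hx).hasDerivWithinAt

theorem IsLake.continuousOn_deriv_rate (L : IsLake b c ρ r) :
    ContinuousOn (derivWithin r (Ici 0)) (Ici 0) :=
  L.rate.contDiffOn.continuousOn_derivWithin (uniqueDiffOn_Ici 0) le_rfl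

theorem valueDeriv_eq {z : ℝ} (hz : 0 < z) :
    valueDeriv b c ρ r z = deriv (value b c ρ r) z :=
  derivWithin_of_mem_nhds (Ici_mem_nhds hz)

theorem valueDeriv_eventuallyEq {z : ℝ} (hz : 0 < z) :
    valueDeriv b c ρ r =ᶠ[𝓝 z] deriv (value b c ρ r) := by
  filter_upwards [lt_mem_nhds hz] with w hw using valueDeriv_eq hw

theorem IsBranch.continuousAt_deriv (L : IsLake b c ρ r) {S : Set ℝ} {q : ℝ}
    (h : IsBranch b c ρ r S q) {z : ℝ} (hz : z ∈ interior S) :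
    ContinuousAt (deriv (value b c ρ r)) z := by
  obtain ⟨p, hp, ht⟩ := h.exists_hasDerivWithinAt L (interior_subset hz)
  rw [← (hp.hasDerivAt (mem_interior_iff_mem_nhds.1 hz)).deriv] at ht
  rw [continuousAt_iff_punctured_nhds]
  refine ht.mono_left (nhdsWithin_le_iff.2 ?_)
  filter_upwards [nhdsWithin_le_nhds (isOpen_interior.mem_nhds hz), self_mem_nhdsWithin]
    with w hw hne using ⟨⟨interior_subset hw, hne⟩, h.interior_subset_diffSet L hw⟩

theorem IsBranch.hasDerivAt_deriv (L : IsLake b c ρ r) {S : Set ℝ} {q : ℝ}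
    (h : IsBranch b c ρ r S q) {z : ℝ} (hz : z ∈ interior S) :
    HasDerivAt (deriv (value b c ρ r)) (secondFormula b c ρ r z (deriv (value b c ρ r) z)) z := by
  have hzE := h.interior_subset_diffSet L hz
  have hnhds : ∀ᶠ w in 𝓝[univ] z, w ∈ diffSet b c ρ r := by
    rw [nhdsWithin_univ]
    filter_upwards [isOpen_interior.mem_nhds hz] with w hw using h.interior_subset_diffSet L hw
  rw [← hasDerivWithinAt_univ]
  refine hasDerivWithinAt_of_ham_eq (mem_univ z) (h.continuousAt_deriv L hz).continuousWithinAt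
    hzE.2.hasDerivAt.hasDerivWithinAt
    ((L.hasDerivWithinAt_rate hzE.1.le).hasDerivAt (Ici_mem_nhds hzE.1)).hasDerivWithinAt
    (hnhds.mono fun w hw => (L.hjb hw.1 hw.2.hasDerivAt).1)
    (hnhds.mono fun w hw => (L.hjb hw.1 hw.2.hasDerivAt).2) ?_
  exact h.drift_ne_zero L (interior_subset hz) (U := pure z)
    (pure_le_nhdsWithin ⟨interior_subset hz, hzE⟩) (tendsto_pure_nhds _ _)

theorem IsBranch.hasSecond (L : IsLake b c ρ r) {S : Set ℝ} {q : ℝ}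
    (h : IsBranch b c ρ r S q) {z : ℝ} (hz : z ∈ interior S) :
    HasSecond b c ρ r z ∧
      valueDeriv₂ b c ρ r z = secondFormula b c ρ r z (deriv (value b c ρ r) z) := by
  have hzE := h.interior_subset_diffSet L hz
  have hd := ((h.hasDerivAt_deriv L hz).congr_of_eventuallyEq
    (valueDeriv_eventuallyEq hzE.1)).hasDerivWithinAt (s := Ici 0)
  refine ⟨⟨?_, hd.differentiableWithinAt⟩, hd.derivWithin (uniqueDiffOn_Ici 0 z hzE.1.le)⟩
  filter_upwards [nhdsWithin_le_nhds (isOpen_interior.mem_nhds hz)] with w hw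
  exact (h.interior_subset_diffSet L hw).2.differentiableWithinAt

/-- The slopes converge at the end point x₀ and the limiting drift does not vanish, so
`secondFormula` passes to the limit. -/
theorem IsBranch.exists_tendsto_valueDeriv₂ (L : IsLake b c ρ r) {S : Set ℝ} {q : ℝ}
    (h : IsBranch b c ρ r S q) {x₀ : ℝ} (hx₀ : x₀ ∈ S) (hS : S \ {x₀} ⊆ interior S)
    [(𝓝[S \ {x₀}] x₀).NeBot] :
    (∀ᶠ z in 𝓝[S \ {x₀}] x₀, HasSecond b c ρ r z) ∧
      ∃ l, Tendsto (valueDeriv₂ b c ρ r) (𝓝[S \ {x₀}] x₀) (𝓝 l) := by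
  obtain ⟨p, -, ht⟩ := h.exists_hasDerivWithinAt L hx₀
  have hsub : S \ {x₀} ⊆ diffSet b c ρ r := hS.trans (h.interior_subset_diffSet L)
  rw [inter_eq_left.2 hsub] at ht
  have hle0 : 𝓝[S \ {x₀}] x₀ ≤ 𝓝[Ici 0] x₀ := nhdsWithin_mono _ (sdiff_subset.trans h.subset)
  have hle1 : 𝓝[S \ {x₀}] x₀ ≤ 𝓝[S ∩ diffSet b c ρ r] x₀ :=
    nhdsWithin_mono _ (subset_inter sdiff_subset hsub)
  have hx0 := h.subset hx₀
  have hp := (L.root_of_tendsto hx0 (hle1.trans (nhdsWithin_mono _ inter_subset_right)) ht).1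
  have hdrift := h.drift_ne_zero L hx₀ hle1 ht
  have hid : Tendsto (fun z : ℝ => z) (𝓝[S \ {x₀}] x₀) (𝓝 x₀) := nhdsWithin_le_nhds
  have hr : Tendsto r (𝓝[S \ {x₀}] x₀) (𝓝 (r x₀)) := (L.continuousOn x₀ hx0).mono_left hle0
  have hr' : Tendsto (derivWithin r (Ici 0)) (𝓝[S \ {x₀}] x₀) (𝓝 (derivWithin r (Ici 0) x₀)) :=
    (L.continuousOn_deriv_rate x₀ hx0).mono_left hle0
  refine ⟨?_, secondFormula b c ρ r x₀ p, ?_⟩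
  · filter_upwards [self_mem_nhdsWithin] with z hz using (h.hasSecond L (hS hz)).1
  · have hlim : Tendsto (fun z => secondFormula b c ρ r z (deriv (value b c ρ r) z))
        (𝓝[S \ {x₀}] x₀) (𝓝 (secondFormula b c ρ r x₀ p)) :=
      (((hr'.const_sub _).mul ht).add (hid.const_mul _)).div
        ((hr.sub (hid.const_mul b)).sub (tendsto_const_nhds.div ht hp.ne)) hdrift
    refine hlim.congr' ?_
    filter_upwards [self_mem_nhdsWithin] with z hz using (h.hasSecond L (hS hz)).2.symm

/-! ### Behaviour at the origin -/

theorem IsLake.continuousOn_gap (L : IsLake b c ρ r) {q : ℝ} (hq : q < 0) :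
    ContinuousOn (fun z => ρ * value b c ρ r z - ham b c r z q) (Ici 0) :=
  (continuousOn_const.mul L.continuousOn_value).sub
    (L.continuousOn_ham.comp (f := fun y => (y, q)) (by fun_prop) fun _ hy => ⟨hy, hq⟩)

/-- The behaviour of the value function at the origin. -/
theorem IsLake.hasSecond_zero (L : IsLake b c ρ r) :
    HasSecond b c ρ r 0 ∧ valueDeriv₂ b c ρ r 0 =
      -(ρ + b - derivWithin r (Ici 0) 0) * (valueDeriv b c ρ r 0) ^ 2 := by
  -- Since `r 0 = 0`, the Hamiltonian at the origin is `-log (-p) - 1`, and this is the only root.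
  set p₀ := -Real.exp (-1 - ρ * value b c ρ r 0) with hp₀
  have hp₀neg : p₀ < 0 := neg_neg_of_pos (Real.exp_pos _)
  have hham0 : ∀ p, ham b c r 0 p = -Real.log (-p) - 1 := fun p => by
    unfold ham; rw [L.rate.map_zero]; ring
  have h0mem : (0 : ℝ) ∈ Ici (0 : ℝ) := mem_Ici.2 le_rfl
  obtain ⟨-, ht⟩ := L.hasDerivWithinAt_of_unique ordConnected_Ici subset_rfl h0mem (p := p₀) (by
    intro p hp
    obtain ⟨U, hU, htU⟩ := mapClusterPt_iff_ultrafilter.1 hp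
    obtain ⟨h1, h2⟩ := L.root_of_tendsto le_rfl
      (hU.trans (nhdsWithin_mono _ inter_subset_right)) htU
    rw [hham0] at h2
    have h3 : Real.log (-p) = -1 - ρ * value b c ρ r 0 := by linarith
    rw [hp₀, ← h3, Real.exp_log (neg_pos.2 h1), neg_neg])
  -- At slope `2 p₀` the Hamiltonian at the origin lies below the level by exactly `log 2`, while
  -- slopes near 0 tend to p₀, which is larger. Thus `2 p₀` separates a branch.
  have hq : 2 * p₀ < 0 := by linarith
  have hgap0 : 0 < ρ * value b c ρ r 0 - ham b c r 0 (2 * p₀) := by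
    have h1 : -(2 * p₀) = 2 * Real.exp (-1 - ρ * value b c ρ r 0) := by rw [hp₀]; ring
    have := Real.log_pos one_lt_two
    rw [hham0, h1, Real.log_mul two_ne_zero (Real.exp_pos _).ne', Real.log_exp]
    linarith
  have hev1 := (L.continuousOn_gap hq 0 h0mem).eventually (lt_mem_nhds hgap0)
  have hev2 := ht.eventually (lt_mem_nhds (show 2 * p₀ < p₀ by linarith))
  rw [eventually_nhdsWithin_iff] at hev1 hev2
  obtain ⟨β, hβ, hball⟩ := Metric.eventually_nhds_iff.1 (hev1.and hev2)
  have hdist : ∀ z ∈ Ico 0 β, dist z 0 < β := fun z hz => by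
    rw [Real.dist_eq, sub_zero, abs_of_nonneg hz.1]; exact hz.2
  have hB : IsBranch b c ρ r (Ico 0 β) (2 * p₀) :=
    ⟨ordConnected_Ico, fun z hz => hz.1, hq,
      fun z hz => sub_pos.1 ((hball (hdist z hz)).1 hz.1),
      Or.inl fun z hz hzE => (hball (hdist z hz)).2 ⟨⟨hz.1, hzE.1.ne'⟩, hzE⟩⟩
  have h0 : (0 : ℝ) ∈ Ico 0 β := ⟨le_rfl, hβ⟩
  have hnhds : Ico 0 β ∈ 𝓝[≥] (0 : ℝ) := Ico_mem_nhdsGE hβ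
  have hsub : Ico 0 β \ {0} ⊆ interior (Ico 0 β) := by
    rw [interior_Ico]
    exact fun z hz => ⟨lt_of_le_of_ne hz.1.1 (Ne.symm hz.2), hz.1.2⟩
  have hsubE := hsub.trans (hB.interior_subset_diffSet L)
  obtain ⟨p, hp, htp⟩ := hB.exists_hasDerivWithinAt L h0
  rw [inter_eq_left.2 hsubE] at htp
  have hpI : HasDerivWithinAt (value b c ρ r) p (Ici 0) 0 := hp.mono_of_mem_nhdsWithin hnhds
  have hg0 : valueDeriv b c ρ r 0 = p := hpI.derivWithin (uniqueDiffOn_Ici 0 0 h0mem)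
  have hIco : Ico 0 β \ {0} = Ioo 0 β := by
    ext z
    exact ⟨fun hz => ⟨lt_of_le_of_ne hz.1.1 (Ne.symm hz.2), hz.1.2⟩,
      fun hz => ⟨⟨hz.1.le, hz.2⟩, hz.1.ne'⟩⟩
  rw [hIco, nhdsWithin_Ioo_eq_nhdsGT hβ] at htp
  have hle1 : 𝓝[>] (0 : ℝ) ≤ 𝓝[Ico 0 β ∩ diffSet b c ρ r] 0 := by
    rw [← nhdsWithin_Ioo_eq_nhdsGT hβ, ← hIco]
    exact nhdsWithin_mono _ (subset_inter sdiff_subset hsubE)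
  obtain ⟨hpneg, hproot⟩ := L.root_of_tendsto le_rfl
    (hle1.trans (nhdsWithin_mono _ inter_subset_right)) htp
  have hdrift := hB.drift_ne_zero L h0 hle1 htp
  have hcont : ContinuousWithinAt (valueDeriv b c ρ r) (Ici 0) 0 := by
    rw [← continuousWithinAt_Ioi_iff_Ici]
    unfold ContinuousWithinAt
    rw [hg0]
    refine htp.congr' ?_
    filter_upwards [self_mem_nhdsWithin] with z hz using (valueDeriv_eq hz).symm
  have hroots : ∀ z ∈ Ico 0 β, valueDeriv b c ρ r z < 0 ∧
      ham b c r z (valueDeriv b c ρ r z) = ρ * value b c ρ r z := by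
    intro z hz
    rcases hz.1.eq_or_lt with h | h
    · rw [← h, hg0]; exact ⟨hpneg, hproot⟩
    · rw [valueDeriv_eq h]
      exact L.hjb h (hsubE ⟨hz, h.ne'⟩).2.hasDerivAt
  have hd := hasDerivWithinAt_of_ham_eq (V := value b c ρ r) (g := valueDeriv b c ρ r) (c := c)
    (ρ := ρ) (b := b) h0mem hcont (by rwa [hg0]) (L.hasDerivWithinAt_rate le_rfl)
    (by filter_upwards [hnhds] with z hz using (hroots z hz).1)
    (by filter_upwards [hnhds] with z hz using (hroots z hz).2) (by rwa [hg0])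
  refine ⟨⟨?_, hd.differentiableWithinAt⟩, ?_⟩
  · filter_upwards [hnhds] with z hz
    rcases hz.1.eq_or_lt with h | h
    · rw [← h]; exact hpI.differentiableWithinAt
    · exact (hsubE ⟨hz, h.ne'⟩).2.differentiableWithinAt
  · rw [valueDeriv₂, hd.derivWithin (uniqueDiffOn_Ici 0 0 h0mem), hg0, L.rate.map_zero]
    field_simp [hpneg.ne]
    ring

/-! ### Behaviour at kinks -/

/-- The behaviour of the value function at its kinks. -/
theorem IsLake.second_near_kink (L : IsLake b c ρ r) {xs : ℝ} (hxs : 0 < xs)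
    (hnd : ¬ DifferentiableAt ℝ (value b c ρ r) xs) :
    ((∀ᶠ x in 𝓝[<] xs, HasSecond b c ρ r x) ∧
        ∃ l : ℝ, Tendsto (valueDeriv₂ b c ρ r) (𝓝[<] xs) (𝓝 l)) ∧
      ((∀ᶠ x in 𝓝[>] xs, HasSecond b c ρ r x) ∧
        ∃ l : ℝ, Tendsto (valueDeriv₂ b c ρ r) (𝓝[>] xs) (𝓝 l)) := by
  set F := 𝓝[(Ici 0 \ {xs}) ∩ diffSet b c ρ r] xs with hF
  have hmem : xs ∈ Ici (0 : ℝ) := hxs.le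
  -- A single limit slope would make V differentiable, so there are at least two.
  have hnot : ∀ p, ∃ p', MapClusterPt p' F (deriv (value b c ρ r)) ∧ p' ≠ p := by
    intro p
    by_contra! hall
    exact hnd ((L.hasDerivWithinAt_of_unique ordConnected_Ici subset_rfl hmem hall).1.hasDerivAt
      (Ici_mem_nhds hxs)).differentiableAt
  obtain ⟨pa, pb, hpa, hpb, hab⟩ : ∃ pa pb, MapClusterPt pa F (deriv (value b c ρ r)) ∧
      MapClusterPt pb F (deriv (value b c ρ r)) ∧ pa < pb := by
    obtain ⟨p₁, h₁, -⟩ := hnot 0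
    obtain ⟨p₂, h₂, hne⟩ := hnot p₁
    rcases lt_or_gt_of_ne hne with h | h
    · exact ⟨p₂, p₁, h₂, h₁, h⟩
    · exact ⟨p₁, p₂, h₁, h₂, h⟩
  have hroot : ∀ p, MapClusterPt p F (deriv (value b c ρ r)) →
      p < 0 ∧ ham b c r xs p = ρ * value b c ρ r xs := by
    intro p hp
    obtain ⟨U, hU, htU⟩ := mapClusterPt_iff_ultrafilter.1 hp
    exact L.root_of_tendsto hxs.le (hU.trans (nhdsWithin_mono _ inter_subset_right)) htU
  obtain ⟨ha1, ha2⟩ := hroot pa hpa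
  obtain ⟨hb1, hb2⟩ := hroot pb hpb
  -- By strict convexity the midpoint of two distinct roots lies strictly below the level, and by
  -- continuity it stays below on a neighbourhood of the kink.
  set q := (pa + pb) / 2 with hq
  have hq0 : q < 0 := by rw [hq]; linarith
  have hqa : pa < q := by rw [hq]; linarith
  have hqb : q < pb := by rw [hq]; linarith
  have hgap : 0 < ρ * value b c ρ r xs - ham b c r xs q := by
    have e1 := ham_tangent_lt (b := b) (c := c) (r := r) (x := xs) hq0 ha1 hqa.ne
    have e2 := ham_tangent_lt (b := b) (c := c) (r := r) (x := xs) hq0 hb1 hqb.ne'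
    rw [ha2] at e1
    rw [hb2] at e2
    have e3 : pa - q = -(pb - q) := by rw [hq]; ring
    rw [e3] at e1
    linarith
  have hev := (((L.continuousOn_gap hq0).continuousAt (Ici_mem_nhds hxs)).eventually
    (lt_mem_nhds hgap)).and (lt_mem_nhds hxs)
  obtain ⟨d, hd, hball⟩ := Metric.eventually_nhds_iff.1 hev
  have hin : ∀ z ∈ Ioo (xs - d) (xs + d), ham b c r z q < ρ * value b c ρ r z ∧ 0 < z := by
    intro z hz
    have := hball (y := z) (by rw [Real.dist_eq, abs_lt]; constructor <;> linarith [hz.1, hz.2])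
    exact ⟨sub_pos.1 this.1, this.2⟩
  have hne : ∀ z ∈ Ioo (xs - d) (xs + d), z ∈ diffSet b c ρ r → deriv (value b c ρ r) z ≠ q := by
    intro z hz hzE he
    have h1 := (L.hjb hzE.1 hzE.2.hasDerivAt).2
    rw [he] at h1
    exact absurd (hin z hz).1 (by rw [h1]; exact lt_irrefl _)
  have hsame : ∀ z₁ z₂, z₁ ∈ Ioo (xs - d) (xs + d) → z₂ ∈ Ioo (xs - d) (xs + d) →
      z₁ ∈ diffSet b c ρ r → z₂ ∈ diffSet b c ρ r → z₁ < z₂ →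
      q < deriv (value b c ρ r) z₁ → deriv (value b c ρ r) z₂ < q → False := by
    intro z₁ z₂ h1 h2 hE1 hE2 hlt hd1 hd2
    exact L.not_slope_drop hq0 hE1.1.le hlt
      (fun y hy => (hin y ⟨h1.1.trans_le hy.1, hy.2.trans_lt h2.2⟩).1)
      hE1.2.hasDerivAt hE2.2.hasDerivAt hd1 hd2
  have hFmem : ∀ᶠ z in F, z ∈ diffSet b c ρ r :=
    (eventually_mem_nhdsWithin).mono fun z hz => hz.2
  -- Slopes close to `pb > q` occur arbitrarily near the kink, in particular to the left of any
  -- given z beyond it. A slope below q at z would then be a forbidden drop.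
  have hright : ∀ z ∈ Ico xs (xs + d), z ∈ diffSet b c ρ r → q < deriv (value b c ρ r) z := by
    intro z hz hzE
    have hzxs : xs < z := lt_of_le_of_ne hz.1 fun h => hnd (h ▸ hzE.2)
    have hzI : z ∈ Ioo (xs - d) (xs + d) := ⟨by linarith, hz.2⟩
    by_contra! hn
    have hfr := (hpb.frequently (lt_mem_nhds hqb)).and_eventually
      (hFmem.and (nhdsWithin_le_nhds (Ioo_mem_nhds (show xs - d < xs by linarith) hzxs)))
    obtain ⟨w, hw1, hw2, hw3⟩ := hfr.exists
    exact hsame w z ⟨hw3.1, hw3.2.trans hz.2⟩ hzI hw2 hzE hw3.2 hw1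
      (lt_of_le_of_ne hn (hne z hzI hzE))
  have hleft : ∀ z ∈ Ioc (xs - d) xs, z ∈ diffSet b c ρ r → deriv (value b c ρ r) z < q := by
    intro z hz hzE
    have hzxs : z < xs := lt_of_le_of_ne hz.2 fun h => hnd (h ▸ hzE.2)
    have hzI : z ∈ Ioo (xs - d) (xs + d) := ⟨hz.1, by linarith⟩
    by_contra! hn
    have hfr := (hpa.frequently (gt_mem_nhds hqa)).and_eventually
      (hFmem.and (nhdsWithin_le_nhds (Ioo_mem_nhds hzxs (show xs < xs + d by linarith))))
    obtain ⟨w, hw1, hw2, hw3⟩ := hfr.exists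
    exact hsame z w hzI ⟨hz.1.trans hw3.1, hw3.2⟩ hzE hw2 hw3.1
      (lt_of_le_of_ne hn (hne z hzI hzE).symm) hw1
  have hR : IsBranch b c ρ r (Ico xs (xs + d)) q :=
    ⟨ordConnected_Ico, fun z hz => hxs.le.trans hz.1, hq0,
      fun z hz => (hin z ⟨by linarith [hz.1], hz.2⟩).1, Or.inl hright⟩
  have hL : IsBranch b c ρ r (Ioc (xs - d) xs) q :=
    ⟨ordConnected_Ioc, fun z hz => (hin z ⟨hz.1, by linarith [hz.2]⟩).2.le, hq0,
      fun z hz => (hin z ⟨hz.1, by linarith [hz.2]⟩).1, Or.inr hleft⟩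
  have eR : Ico xs (xs + d) \ {xs} = Ioo xs (xs + d) := by
    ext z
    exact ⟨fun hz => ⟨lt_of_le_of_ne hz.1.1 (Ne.symm hz.2), hz.1.2⟩,
      fun hz => ⟨⟨hz.1.le, hz.2⟩, hz.1.ne'⟩⟩
  have eL : Ioc (xs - d) xs \ {xs} = Ioo (xs - d) xs := by
    ext z
    exact ⟨fun hz => ⟨hz.1.1, lt_of_le_of_ne hz.1.2 hz.2⟩,
      fun hz => ⟨⟨hz.1, hz.2.le⟩, hz.2.ne⟩⟩
  have nR : 𝓝[Ico xs (xs + d) \ {xs}] xs = 𝓝[>] xs := by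
    rw [eR, nhdsWithin_Ioo_eq_nhdsGT (by linarith)]
  have nL : 𝓝[Ioc (xs - d) xs \ {xs}] xs = 𝓝[<] xs := by
    rw [eL, nhdsWithin_Ioo_eq_nhdsLT (by linarith)]
  constructor
  · have : (𝓝[Ioc (xs - d) xs \ {xs}] xs).NeBot := by rw [nL]; infer_instance
    have := hL.exists_tendsto_valueDeriv₂ L (x₀ := xs) ⟨by linarith, le_rfl⟩
      (by rw [eL, interior_Ioc])
    rwa [nL] at this
  · have : (𝓝[Ico xs (xs + d) \ {xs}] xs).NeBot := by rw [nR]; infer_instance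
    have := hR.exists_tendsto_valueDeriv₂ L (x₀ := xs) ⟨le_rfl, by linarith⟩
      (by rw [eR, interior_Ico])
    rwa [nR] at this

/-! ### Behaviour at infinity -/

/-- For large states the slope of the value function lies on the left branch. -/
theorem IsLake.exists_isBranch_Ioi (L : IsLake b c ρ r) :
    ∃ X, 0 ≤ X ∧ IsBranch b c ρ r (Ioi X) (-1) ∧
      ∀ z > X, deriv (value b c ρ r) z < -1 := by
  have hb := L.hb
  have hc := L.hc
  have hρ := L.hρ
  obtain ⟨C₀, C₁, hlow⟩ := L.exists_le_value
  set A := c / (ρ + 2 * b) with hA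
  have hA0 : 0 < A := by positivity
  have hAc : c - ρ * A = 2 * b * A := by rw [hA]; field_simp; ring
  set κ := 2 * b * A with hκ
  have hκ0 : 0 < κ := by positivity
  set N := |b + ρ * C₁| + |ρ * C₀| with hN
  set X := max 1 (N / κ) with hX
  have hX1 : 1 ≤ X := le_max_left _ _
  -- The left side is at most `-c z² + b z - 1`, whereas `ρ V` is at least `-ρ A z²` up to linear
  -- terms; the quadratic margin is `c - ρ A = 2 b A > 0`.
  have hham : ∀ z ≥ X, ham b c r z (-1) < ρ * value b c ρ r z := by
    intro z hz
    have hz1 : 1 ≤ z := hX1.trans hz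
    have h1 := mul_le_mul_of_nonneg_left (hlow z (by linarith)) hρ.le
    have h2 : N ≤ κ * z := by
      have := (div_le_iff₀ hκ0).1 ((le_max_right 1 (N / κ)).trans hz)
      linarith
    have h3 : |b + ρ * C₁| * z + |ρ * C₀| ≤ κ * z ^ 2 := by
      have h4 := mul_le_mul_of_nonneg_right h2 (by linarith : 0 ≤ z)
      have h5 : |ρ * C₀| ≤ |ρ * C₀| * z := le_mul_of_one_le_right (abs_nonneg _) hz1
      rw [hN] at h4
      linarith
    have h6 : (b + ρ * C₁) * z ≤ |b + ρ * C₁| * z := by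
      gcongr
      exact le_abs_self _
    have h7 := le_abs_self (ρ * C₀)
    have h8 := L.nonneg z (by linarith)
    have h9 : κ * z ^ 2 = c * z ^ 2 - ρ * A * z ^ 2 := by rw [← hAc]; ring
    unfold ham
    rw [neg_neg, Real.log_one]
    linarith
  have hside : ∀ z ∈ Ioi X, z ∈ diffSet b c ρ r → deriv (value b c ρ r) z < -1 := by
    intro z hz hzE
    by_contra! hn
    have hne : deriv (value b c ρ r) z ≠ -1 := by
      intro he
      have h1 := (L.hjb hzE.1 hzE.2.hasDerivAt).2
      rw [he] at h1
      exact absurd (hham z (le_of_lt hz)) (by rw [h1]; exact lt_irrefl _)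
    have hlt : -1 < deriv (value b c ρ r) z := lt_of_le_of_ne hn hne.symm
    have hd : HasDerivAt (fun y => value b c ρ r y - (-1) * y)
        (deriv (value b c ρ r) z - (-1)) z := by
      refine hzE.2.hasDerivAt.sub (((hasDerivAt_id z).const_mul (-1 : ℝ)).congr_deriv ?_)
      ring
    obtain ⟨y, hy, hyz⟩ := exists_gt_of_hasDerivAt_pos hd (by linarith)
      (show z < z + 1 by linarith)
    have hA2 : A / 2 * (ρ + 2 * b) < c := by
      rw [hA]
      field_simp
      norm_num
    -- A slope above -1 at z makes `V(y) + y` rise after z, but the quadratic upper bound brings it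
    -- down again at a large M. This is a peak, excluded by `IsLake.not_peak`.
    obtain ⟨B, hB⟩ := L.exists_value_le (half_pos hA0) hA2
    obtain ⟨M, hMy, hMA, hMB⟩ : ∃ M, y < M ∧ 4 / A < M ∧
        B - (value b c ρ r z - (-1) * z) < M := by
      obtain ⟨M, hM⟩ := exists_gt (max (max y (4 / A)) (B - (value b c ρ r z - (-1) * z)))
      exact ⟨M, ((le_max_left _ _).trans (le_max_left _ _)).trans_lt hM,
        ((le_max_right _ _).trans (le_max_left _ _)).trans_lt hM, (le_max_right _ _).trans_lt hM⟩
    have hM0 : 0 < M := hzE.1.trans (hy.1.trans hMy)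
    have hVM := hB M hM0.le
    have hM4 : 4 ≤ A * M := by
      have := (div_lt_iff₀ hA0).1 hMA
      linarith
    have hquad : 2 * M ≤ A / 2 * (1 + M) ^ 2 := by nlinarith
    have hend : value b c ρ r M - (-1) * M < value b c ρ r y - (-1) * y := by linarith
    exact L.not_peak (q := -1) (z₁ := z) (z₂ := M) (y₀ := y) (by norm_num) hzE.1.le
      ⟨hy.1.le, hMy.le⟩ (fun w hw => hham w ((le_of_lt hz).trans hw.1)) hyz hend
  have hBr : IsBranch b c ρ r (Ioi X) (-1) :=
    ⟨ordConnected_Ioi, fun z hz => (zero_le_one.trans hX1).trans (le_of_lt hz),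
      by norm_num, fun z hz => hham z (le_of_lt hz), Or.inr hside⟩
  refine ⟨X, by linarith, hBr, fun z hz => hside z hz ?_⟩
  exact hBr.interior_subset_diffSet L (by rwa [interior_Ioi])

theorem tendsto_const_div_sq (k : ℝ) : Tendsto (fun x : ℝ => k / x ^ 2) atTop (𝓝 0) :=
  tendsto_const_nhds.div_atTop (tendsto_pow_atTop two_ne_zero)

/-- The lower bound has the sharp coefficient A, and the upper bound is available for every positive
`A' < A`. -/
theorem IsLake.tendsto_value_div_sq (L : IsLake b c ρ r) :
    Tendsto (fun x => value b c ρ r x / x ^ 2) atTop (𝓝 (-(c / (ρ + 2 * b)))) := by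
  have hb := L.hb
  have hc := L.hc
  have hρ := L.hρ
  set A := c / (ρ + 2 * b) with hA
  have hA0 : 0 < A := by positivity
  rw [tendsto_order]
  constructor
  · intro k hk
    obtain ⟨C₀, C₁, hlow⟩ := L.exists_le_value
    have hlim : Tendsto (fun x : ℝ => -A - C₁ / x - C₀ / x ^ 2) atTop (𝓝 (-A - 0 - 0)) :=
      (tendsto_const_nhds.sub (tendsto_const_nhds.div_atTop tendsto_id)).sub
        (tendsto_const_div_sq C₀)
    rw [sub_zero, sub_zero] at hlim
    filter_upwards [hlim.eventually (lt_mem_nhds hk), eventually_gt_atTop 0] with x hx hx0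
    refine hx.trans_le ?_
    rw [le_div_iff₀ (by positivity)]
    refine le_trans (le_of_eq ?_) (hlow x hx0.le)
    rw [← hA]
    field_simp
  · intro k hk
    obtain ⟨A', hA'0, hA'A, hA'k⟩ : ∃ A', 0 < A' ∧ A' < A ∧ -A' < k := by
      obtain ⟨A', h1, h2⟩ := exists_between (max_lt hA0 (by linarith : -k < A))
      exact ⟨A', (le_max_left _ _).trans_lt h1, h2, by linarith [(le_max_right 0 (-k)).trans_lt h1]⟩
    have hA'c : A' * (ρ + 2 * b) < c := by
      have h1 : A * (ρ + 2 * b) = c := by rw [hA]; field_simp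
      rw [← h1]
      gcongr
    obtain ⟨B, hB⟩ := L.exists_value_le hA'0 hA'c
    have hlim : Tendsto (fun x : ℝ => B / x ^ 2 - A') atTop (𝓝 (0 - A')) :=
      (tendsto_const_div_sq B).sub_const A'
    rw [zero_sub] at hlim
    filter_upwards [hlim.eventually (gt_mem_nhds hA'k), eventually_gt_atTop 0] with x hx hx0
    refine lt_of_le_of_lt ?_ hx
    rw [div_le_iff₀ (by positivity)]
    have h1 : (B / x ^ 2 - A') * x ^ 2 = B - A' * x ^ 2 := by field_simp
    rw [h1]
    have h2 : A' * x ^ 2 ≤ A' * (1 + x) ^ 2 := by gcongr; linarith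
    linarith [hB x hx0.le]

theorem IsLake.tendsto_rate_div (L : IsLake b c ρ r) :
    Tendsto (fun x => r x / x) atTop (𝓝 0) := by
  obtain ⟨a, _, ha, _⟩ := L.rate.limits
  exact ha.div_atTop tendsto_id

theorem IsLake.tendsto_deriv_div (L : IsLake b c ρ r) :
    Tendsto (fun x => deriv (value b c ρ r) x / x) atTop (𝓝 (-2 * (c / (ρ + 2 * b)))) := by
  have hb := L.hb
  have hc := L.hc
  have hρ := L.hρ
  obtain ⟨X, hX0, hB, hX⟩ := L.exists_isBranch_Ioi
  set A := c / (ρ + 2 * b) with hA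
  have hAc : c - ρ * A = 2 * b * A := by rw [hA]; field_simp; ring
  set R : ℝ → ℝ := fun x => ρ * (value b c ρ r x / x ^ 2) + 1 / x ^ 2 + c with hR
  have hRlim : Tendsto R atTop (𝓝 (2 * b * A)) := by
    have := ((L.tendsto_value_div_sq.const_mul ρ).add (tendsto_const_div_sq 1)).add_const c
    rw [← hA] at this
    convert this using 2
    linarith
  have hinv : Tendsto (fun x : ℝ => 1 / x) atTop (𝓝 0) :=
    tendsto_const_nhds.div_atTop tendsto_id
  have hd1 : Tendsto (fun x => b - r x / x) atTop (𝓝 b) := by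
    simpa using L.tendsto_rate_div.const_sub b
  have hd2 : Tendsto (fun x => b - r x / x - 1 / x) atTop (𝓝 b) := by
    simpa using hd1.sub hinv
  have hval : 2 * b * A / b = 2 * A := by field_simp
  -- As `p < -1`, one has `0 ≤ log (-p) ≤ -p - 1`. Inserting these bounds into the equation squeezes
  -- `p / x` between two explicit quotients with the same limit.
  have l1 : Tendsto (fun x => -(R x / (b - r x / x - 1 / x))) atTop (𝓝 (-2 * A)) := by
    have := (hRlim.div hd2 hb.ne').neg
    rwa [hval, ← neg_mul] at this
  have l2 : Tendsto (fun x => -(R x / (b - r x / x))) atTop (𝓝 (-2 * A)) := by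
    have := (hRlim.div hd1 hb.ne').neg
    rwa [hval, ← neg_mul] at this
  refine tendsto_of_tendsto_of_tendsto_of_le_of_le' l1 l2 ?_ ?_
  all_goals
    filter_upwards [eventually_gt_atTop X, eventually_gt_atTop 0,
      hd1.eventually (lt_mem_nhds hb), hd2.eventually (lt_mem_nhds hb)] with x hxX hx0 h1 h2
    have hxE := hB.interior_subset_diffSet L (by rwa [interior_Ioi] : x ∈ interior (Ioi X))
    obtain ⟨hneg, hham⟩ := L.hjb hxE.1 hxE.2.hasDerivAt
    have hlt := hX x hxX
    set p := deriv (value b c ρ r) x with hp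
    have hlog0 : 0 ≤ Real.log (-p) := Real.log_nonneg (by linarith)
    have hlog1 := Real.log_le_sub_one_of_pos (neg_pos.2 hneg)
    unfold ham at hham
    have hRx : R x = (ρ * value b c ρ r x + 1 + c * x ^ 2) / x ^ 2 := by
      simp only [hR]; field_simp
  · rw [neg_le, ← neg_div, le_div_iff₀ h2, hRx, le_div_iff₀ (by positivity)]
    have : -p / x * (b - r x / x - 1 / x) * x ^ 2 = -p * (b * x - r x - 1) := by field_simp
    rw [this]
    linarith
  · rw [le_neg, ← neg_div, div_le_iff₀ h1, hRx, div_le_iff₀ (by positivity)]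
    have : -p / x * (b - r x / x) * x ^ 2 = -p * (b * x - r x) := by field_simp
    rw [this]
    linarith

theorem IsLake.tendsto_valueDeriv₂ (L : IsLake b c ρ r) :
    (∀ᶠ x in atTop, HasSecond b c ρ r x) ∧
      Tendsto (valueDeriv₂ b c ρ r) atTop (𝓝 (-2 * (c / (ρ + 2 * b)))) := by
  have hb := L.hb
  have hc := L.hc
  have hρ := L.hρ
  obtain ⟨X, hX0, hB, hX⟩ := L.exists_isBranch_Ioi
  have hint : ∀ x > X, x ∈ interior (Ioi X) := fun x hx => by rwa [interior_Ioi]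
  refine ⟨?_, ?_⟩
  · filter_upwards [eventually_gt_atTop X] with x hx using (hB.hasSecond L (hint x hx)).1
  have hg := L.tendsto_deriv_div
  set A := c / (ρ + 2 * b) with hA
  have hA0 : 0 < A := by positivity
  -- This is `secondFormula` with numerator and denominator divided by x; the limit is `-2 A`
  -- because `c = A (ρ + 2 b)`.
  have hlim : Tendsto (fun x => ((ρ + b - derivWithin r (Ici 0) x) *
      (deriv (value b c ρ r) x / x) + 2 * c) /
      (r x / x - b - (deriv (value b c ρ r) x / x)⁻¹ * (1 / x ^ 2))) atTop
      (𝓝 (((ρ + b - 0) * (-2 * A) + 2 * c) / (0 - b - (-2 * A)⁻¹ * 0))) :=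
    (((L.rate.deriv_tendsto.const_sub (ρ + b)).mul hg).add_const (2 * c)).div
      ((L.tendsto_rate_div.sub_const b).sub
        ((hg.inv₀ (by linarith)).mul (tendsto_const_div_sq 1))) (by simpa using hb.ne')
  have hval : ((ρ + b - 0) * (-2 * A) + 2 * c) / (0 - b - (-2 * A)⁻¹ * 0) = -2 * A := by
    have h1 : c = A * (ρ + 2 * b) := by rw [hA]; field_simp
    rw [h1, mul_zero, sub_zero, zero_sub, div_eq_iff (by linarith)]
    ring
  rw [hval] at hlim
  refine hlim.congr' ?_
  filter_upwards [eventually_gt_atTop X] with x hx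
  have hx0 : 0 < x := hX0.trans_lt hx
  have hp : deriv (value b c ρ r) x ≠ 0 := by linarith [hX x hx]
  rw [(hB.hasSecond L (hint x hx)).2, secondFormula]
  set p := deriv (value b c ρ r) x
  have e1 : (ρ + b - derivWithin r (Ici 0) x) * p + 2 * c * x =
      x * ((ρ + b - derivWithin r (Ici 0) x) * (p / x) + 2 * c) := by field_simp
  have e2 : r x - b * x - 1 / p = x * (r x / x - b - (p / x)⁻¹ * (1 / x ^ 2)) := by
    field_simp
  rw [e1, e2, mul_div_mul_left _ _ hx0.ne']

theorem IsLake.eventually_hasFirst (L : IsLake b c ρ r) :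
    (∀ᶠ x in atTop, HasFirst b c ρ r x) ∧
      Tendsto (fun x => valueDeriv b c ρ r x / x) atTop (𝓝 (-2 * (c / (ρ + 2 * b)))) := by
  obtain ⟨X, hX0, hB, hX⟩ := L.exists_isBranch_Ioi
  constructor
  · filter_upwards [eventually_gt_atTop X] with x hx
    exact (hB.interior_subset_diffSet L
      (by rwa [interior_Ioi] : x ∈ interior (Ioi X))).2.differentiableWithinAt
  · refine L.tendsto_deriv_div.congr' ?_
    filter_upwards [eventually_gt_atTop 0] with x hx
    rw [valueDeriv_eq hx]

end ShallowLake

theorem mainTheorem12 (b c ρ : ℝ) (hb : 0 < b) (hc : 0 < c) (hρ : 0 < ρ)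
    (r : ℝ → ℝ) (hr : ShallowLake.IsRecyclingRate b ρ r) :
    -- the value function is finite on `[0, ∞)`
    (∀ x : ℝ, 0 ≤ x → ∃ v : ℝ, ShallowLake.extendedValue b c ρ r x = (v : EReal)) ∧
    -- (i)
    ((∀ᶠ x in atTop, ShallowLake.HasFirst b c ρ r x) ∧
      Tendsto (fun x => ShallowLake.valueDeriv b c ρ r x / x) atTop
        (𝓝 (-2 * (c / (ρ + 2 * b))))) ∧
    -- (ii)
    ((∀ᶠ x in atTop, ShallowLake.HasSecond b c ρ r x) ∧
      Tendsto (ShallowLake.valueDeriv₂ b c ρ r) atTop (𝓝 (-2 * (c / (ρ + 2 * b))))) ∧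
    -- (iii)
    (ShallowLake.HasSecond b c ρ r 0 ∧
      ShallowLake.valueDeriv₂ b c ρ r 0 =
        -(ρ + b - derivWithin r (Ici 0) 0) * (ShallowLake.valueDeriv b c ρ r 0) ^ 2) ∧
    -- (iv)
    (∀ xs : ℝ, ShallowLake.IsSkibaPoint b c ρ r xs →
      ((∀ᶠ x in 𝓝[<] xs, ShallowLake.HasSecond b c ρ r x) ∧
        ∃ l : ℝ, Tendsto (ShallowLake.valueDeriv₂ b c ρ r) (𝓝[<] xs) (𝓝 l)) ∧
      ((∀ᶠ x in 𝓝[>] xs, ShallowLake.HasSecond b c ρ r x) ∧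
        ∃ l : ℝ, Tendsto (ShallowLake.valueDeriv₂ b c ρ r) (𝓝[>] xs) (𝓝 l))) := by
  have L : ShallowLake.IsLake b c ρ r := ⟨hb, hc, hρ, hr⟩
  exact ⟨fun x hx => ⟨_, (L.value_spec hx).1⟩, L.eventually_hasFirst, L.tendsto_valueDeriv₂,
    L.hasSecond_zero, fun xs h => L.second_near_kink h.pos h.not_differentiableAt⟩
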